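/- Let $\mathbb K$ be a field of characteristic $2$. Let $\mathfrak g=\bigoplus_{k\ge -d}\mathfrak g_k$ be a simple Lie algebra over $\mathbb K$ (possibly infinite-dimensional) with a Weisfeiler grading: $\mathfrak g_{\ge 0}$ is a maximal subalgebra of finite codimension, $\mathfrak g_{-1}\ne 0$ is an irreducible $\mathfrak g_0$-module, $\mathfrak g_{k-1}=[\mathfrak g_{-1},\mathfrak g_{k}]$ for $k<0$, and if $x\in\mathfrak g_k$, $k\ge 0$, satisfies $[x,\mathfrak g_{-1}]=0$, then $x=0$. Suppose that $\mathfrak g$ is vectorial in the sense that it is the full Cartan prolong of its non-positive part, without constraint on the shearing vector. Here a $\mathbb Z$-graded Lie (super)algebra $\mathfrak h$ is called \emph{transitive} if $x\in\mathfrak h_k$, $k\ge 0$, $[x,\mathfrak h_{<0}]=0$ imply $x=0$. It is the \emph{full Cartan prolong} of its non-positive part $\mathfrak h_{\le 0}$ if it is transitive and for $k>0$ its component $\mathfrak h_k$ consists of all derivations of degree $k$ from $\mathfrak h_{<0}$ to $\mathfrak h$, that is, each such derivation is $x\mapsto [z,x]$ for some $z\in\mathfrak h_k$. In characteristic $2$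 a Lie superalgebra has a squaring $x\mapsto x^2$ of odd elements with $[x^2,y]=[x,[x,y]]$ whose polarization is the bracket, and derivations $D$ are required to satisfy $D(x^2)=[Dx,x]$ for odd $x$. Let $\mathrm{gr}$ be the $\mathbb Z/2$-grading of $\mathfrak g$ obtained by reducing the $\mathbb Z$-grading modulo $2$. Let $(\mathfrak g,\mathrm{gr})$ be the smallest subalgebra of the restricted closure of $\mathfrak g$ (the smallest subalgebra of $\mathrm{End}(\mathfrak g)$ that contains $\mathrm{ad}\,\mathfrak g\cong\mathfrak g$ and is closed under $f\mapsto f^{[2]}=f^2$) that contains $\mathfrak g$ and all $x^{[2]}$ with $x\in\mathfrak g$ odd, and let $S(\mathfrak g,\mathrm{gr})$ be the $\mathbb Z$-graded Lie superalgebra on the space $(\mathfrak g,\mathrm{gr})$ with squaring $x^2:=x^{[2]}$ for odd $x$. Then $S(\mathfrak g,\mathrm{gr})$ is completely determined by its non-positive part: it is the full Cartan prolong of its non-positive part. Moreover, for every transitive $\mathbb Z$-graded Lie superalgebra $\mathfrak h$, each isomorphism of $\mathbb Z$-graded Lie superalgebras $\mathfrak h_{\le 0}\to S(\mathfrak g,\mathrm{gr})_{\le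 0}$ extends uniquely to a homomorphism of $\mathbb Z$-graded Lie superalgebras $\mathfrak h\to S(\mathfrak g,\mathrm{gr})$; this extension is injective, and it is bijective if $\mathfrak h$ is the full Cartan prolong of $\mathfrak h_{\le 0}$. In particular, $S(\mathfrak g,\mathrm{gr})$ is never merely a partial prolong. -/

import Mathlib

/-- A `ℤ`-grading of a Lie algebra `L = ⨁ₖ Lₖ` with `[Lᵢ, Lⱼ] ⊆ Lᵢ₊ⱼ`. -/
structure LieGrading (K L : Type*) [Field K] [LieRing L] [LieAlgebra K L] where
  piece : ℤ → Submodule K L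
  isInternal : DirectSum.IsInternal piece
  lie_mem : ∀ {i j : ℤ} {x y : L}, x ∈ piece i → y ∈ piece j → ⁅x, y⁆ ∈ piece (i + j)

namespace LieGrading

section
variable {K L : Type*} [Field K] [LieRing L] [LieAlgebra K L] (A : LieGrading K L)

/-- The sum of the homogeneous components with degree in `P`. -/
def part (P : Set ℤ) : Submodule K L := ⨆ k ∈ P, A.piece k

theorem part_induction {P : Set ℤ} {p : L → Prop}
    (hmem : ∀ k ∈ P, ∀ x ∈ A.piece k, p x) (h0 : p 0) (hadd : ∀ x y, p x → p y → p (x + y))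
    {x : L} (hx : x ∈ A.part P) : p x := by
  refine Submodule.iSup_induction (motive := p) (fun k => ⨆ (_ : k ∈ P), A.piece k) hx ?_ h0 hadd
  intro k y hy
  by_cases hk : k ∈ P
  · exact hmem k hk y (by simpa [hk] using hy)
  · have : y = 0 := by simpa [hk] using hy
    exact this ▸ h0

theorem piece_le_part {P : Set ℤ} {k : ℤ} (hk : k ∈ P) : A.piece k ≤ A.part P :=
  le_iSup₂_of_le k hk le_rfl

theorem lie_mem_part {P Q R : Set ℤ} (h : ∀ i ∈ P, ∀ j ∈ Q, i + j ∈ R) {x y : L}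
    (hx : x ∈ A.part P) (hy : y ∈ A.part Q) : ⁅x, y⁆ ∈ A.part R := by
  refine A.part_induction (p := fun x => ⁅x, y⁆ ∈ A.part R) ?_ (by simp) ?_ hx
  · intro i hi a ha
    refine A.part_induction (p := fun y => ⁅a, y⁆ ∈ A.part R) ?_ (by simp) ?_ hy
    · intro j hj b hb
      exact A.piece_le_part (h i hi j hj) (A.lie_mem ha hb)
    · intro b c hb hc
      rw [lie_add]; exact add_mem hb hc
  · intro a b ha hb
    rw [add_lie]; exact add_mem ha hb

theorem iSup_piece : ⨆ k, A.piece k = ⊤ := A.isInternal.submodule_iSup_eq_top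

theorem part_univ : A.part Set.univ = ⊤ := by
  simpa [part] using A.iSup_piece

/-- The negative part `⨁_{k < 0} Lₖ`. -/
def neg : LieSubalgebra K L where
  toSubmodule := A.part (Set.Iio 0)
  lie_mem' := A.lie_mem_part (fun i hi j hj => by simp only [Set.mem_Iio] at *; omega)

/-- The non-positive part `⨁_{k ≤ 0} Lₖ`. -/
def nonpos : LieSubalgebra K L where
  toSubmodule := A.part (Set.Iic 0)
  lie_mem' := A.lie_mem_part (fun i hi j hj => by simp only [Set.mem_Iic] at *; omega)

/-- The part of even (`ε = 0`) or odd (`ε = 1`) degree: the `ℤ/2`-grading obtained by reducing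
the `ℤ`-grading modulo 2. -/
def mod2 (ε : ZMod 2) : Submodule K L := A.part {k | (k : ZMod 2) = ε}

/-- Transitivity: an element of degree `≥ 0` that commutes with the negative part is zero. -/
def IsTransitive : Prop :=
  ∀ k : ℤ, 0 ≤ k → ∀ x ∈ A.piece k, (∀ y ∈ A.neg, ⁅x, y⁆ = 0) → x = 0

/-- `L` is the full (generalized) Cartan prolong of its non-positive part, no constraint being put
on the shearing vector. The prolong is built recursively: its component of degree `k > 0`
consists of all derivations of degree `k` from the negative part to the sum of the components of
degree `< k`. So `L` is that prolong if and only if it is transitive and, for `k > 0`, each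
derivation of degree `k` from the negative part to `L` is the bracket with an element of `Lₖ`. -/
def IsFullProlong : Prop :=
  A.IsTransitive ∧
  ∀ k : ℤ, 0 < k → ∀ D : LieDerivation K A.neg L,
    (∀ j : ℤ, ∀ x : A.neg, (x : L) ∈ A.piece j → D x ∈ A.piece (j + k)) →
    ∃ z ∈ A.piece k, ∀ x : A.neg, D x = ⁅z, (x : L)⁆

/-- A Weisfeiler grading: the grading whose associated filtration by the `⨁_{k ≥ i} Lₖ` is a
Weisfeiler filtration, attached to a maximal subalgebra of finite codimension. -/
structure IsWeisfeiler : Prop where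
  /-- the grading has finite depth -/
  depth : ∃ d : ℤ, ∀ k < d, A.piece k = ⊥
  /-- the non-negative part has finite codimension -/
  finite : ∀ k < 0, FiniteDimensional K (A.piece k)
  /-- the non-negative part is a maximal subalgebra -/
  maximal : ∀ M : LieSubalgebra K L, A.part (Set.Ici 0) ≤ M.toSubmodule →
    M.toSubmodule = A.part (Set.Ici 0) ∨ M = ⊤
  /-- the component of degree `-1` is non-zero and irreducible over that of degree `0` -/
  ne_bot : A.piece (-1) ≠ ⊥
  irreducible : ∀ W : Submodule K L, W ≤ A.piece (-1) →
    (∀ x ∈ A.piece 0, ∀ w ∈ W, ⁅x, w⁆ ∈ W) → W = ⊥ ∨ W = A.piece (-1)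
  /-- the component of degree `-1` generates the negative part -/
  generated : ∀ k < 0, A.piece (k - 1) =
    Submodule.span K {z | ∃ x ∈ A.piece (-1), ∃ y ∈ A.piece k, z = ⁅x, y⁆}
  /-- transitivity with respect to the component of degree `-1` -/
  transitive : ∀ k : ℤ, 0 ≤ k → ∀ x ∈ A.piece k, (∀ y ∈ A.piece (-1), ⁅x, y⁆ = 0) → x = 0

theorem mod2_isInternal : DirectSum.IsInternal A.mod2 := by
  have h01 : (0 : ZMod 2) ≠ 1 := by decide
  rw [DirectSum.isInternal_submodule_iff_isCompl A.mod2 h01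
    (by ext x; revert x; simp; decide)]
  constructor
  · refine A.isInternal.submodule_iSupIndep.disjoint_biSup_biSup ?_
    rw [Set.disjoint_left]
    intro k hk hk'
    exact h01 (hk.symm.trans hk')
  · rw [codisjoint_iff, eq_top_iff, ← A.iSup_piece]
    refine iSup_le fun k => ?_
    have h2 : (k : ZMod 2) = 0 ∨ (k : ZMod 2) = 1 := by
      generalize (k : ZMod 2) = e; revert e; decide
    rcases h2 with h2 | h2
    · exact le_trans (A.piece_le_part (P := {k : ℤ | (k : ZMod 2) = 0}) h2) le_sup_left
    · exact le_trans (A.piece_le_part (P := {k : ℤ | (k : ZMod 2) = 1}) h2) le_sup_right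

theorem lie_mem_mod2 {ε δ : ZMod 2} {x y : L} (hx : x ∈ A.mod2 ε) (hy : y ∈ A.mod2 δ) :
    ⁅x, y⁆ ∈ A.mod2 (ε + δ) := by
  refine A.lie_mem_part ?_ hx hy
  intro i hi j hj
  simp only [Set.mem_ofPred_eq] at *
  push_cast; rw [hi, hj]

theorem mod2_disjoint : Disjoint (A.mod2 0) (A.mod2 1) := by
  have h01 : (0 : ZMod 2) ≠ 1 := by decide
  exact A.mod2_isInternal.submodule_iSupIndep.pairwiseDisjoint h01

theorem exists_mod2 (x : L) : ∃ a ∈ A.mod2 0, ∃ b ∈ A.mod2 1, x = a + b := by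
  have h01 : (0 : ZMod 2) ≠ 1 := by decide
  have h := (DirectSum.isInternal_submodule_iff_isCompl A.mod2 h01
    (by ext x; revert x; simp; decide)).1 A.mod2_isInternal
  have hx : x ∈ A.mod2 0 ⊔ A.mod2 1 := by rw [h.sup_eq_top]; trivial
  obtain ⟨a, ha, b, hb, rfl⟩ := Submodule.mem_sup.1 hx
  exact ⟨a, ha, b, hb, rfl⟩

end

end LieGrading

/-- A `ℤ`-graded Lie superalgebra in characteristic 2. The underlying Lie algebra, obtained by
forgetting the squaring (so that `[x, x] = 2 x² = 0` for odd `x`), is `L`; the even and the odd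
part are `parity 0` and `parity 1`. The squaring `sq` is meaningful on the odd part only; its
polarization is the bracket of odd elements. -/
structure GradedLieSuperalgebra (K L : Type*) [Field K] [LieRing L] [LieAlgebra K L]
    extends LieGrading K L where
  parity : ZMod 2 → Submodule K L
  parity_isInternal : DirectSum.IsInternal parity
  lie_mem_parity : ∀ {i j : ZMod 2} {x y : L},
    x ∈ parity i → y ∈ parity j → ⁅x, y⁆ ∈ parity (i + j)
  /-- each homogeneous component is a graded subspace -/
  piece_parity : ∀ k : ℤ, piece k = (piece k ⊓ parity 0) ⊔ (piece k ⊓ parity 1)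
  sq : L → L
  sq_mem : ∀ {x : L}, x ∈ parity 1 → sq x ∈ parity 0
  sq_mem_piece : ∀ {k : ℤ} {x : L}, x ∈ parity 1 → x ∈ piece k → sq x ∈ piece (2 * k)
  sq_smul : ∀ (a : K) {x : L}, x ∈ parity 1 → sq (a • x) = a ^ 2 • sq x
  sq_add : ∀ {x y : L}, x ∈ parity 1 → y ∈ parity 1 → sq (x + y) = sq x + sq y + ⁅x, y⁆
  sq_lie : ∀ {x : L} (y : L), x ∈ parity 1 → ⁅sq x, y⁆ = ⁅x, ⁅x, y⁆⁆

namespace GradedLieSuperalgebra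

variable {K L M : Type*} [Field K] [LieRing L] [LieAlgebra K L] [LieRing M] [LieAlgebra K M]

/-- The graded Lie superalgebra is the full Cartan prolong of its non-positive part (as a Lie
superalgebra, without constraint on the shearing vector). As for Lie algebras, but a derivation
`D` of a Lie superalgebra in characteristic 2 also satisfies `D (x²) = [D x, x]` for odd `x`. -/
def IsFullProlong (A : GradedLieSuperalgebra K L) : Prop :=
  A.IsTransitive ∧
  ∀ k : ℤ, 0 < k → ∀ D : LieDerivation K A.neg L,
    (∀ x y : A.neg, (x : L) ∈ A.parity 1 → (y : L) = A.sq x → D y = ⁅D x, (x : L)⁆) →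
    (∀ j : ℤ, ∀ x : A.neg, (x : L) ∈ A.piece j → D x ∈ A.piece (j + k)) →
    ∃ z ∈ A.piece k, ∀ x : A.neg, D x = ⁅z, (x : L)⁆

/-- Homomorphisms of `ℤ`-graded Lie superalgebras. -/
structure IsHom (A : GradedLieSuperalgebra K L) (B : GradedLieSuperalgebra K M)
    (f : L →ₗ⁅K⁆ M) : Prop where
  piece : ∀ k : ℤ, ∀ x ∈ A.piece k, f x ∈ B.piece k
  parity : ∀ ε : ZMod 2, ∀ x ∈ A.parity ε, f x ∈ B.parity ε
  sq : ∀ x ∈ A.parity 1, f (A.sq x) = B.sq (f x)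

/-- Isomorphisms between the non-positive parts of two `ℤ`-graded Lie superalgebras. -/
structure IsNonposIso (A : GradedLieSuperalgebra K L) (B : GradedLieSuperalgebra K M)
    (e : A.nonpos ≃ₗ⁅K⁆ B.nonpos) : Prop where
  piece : ∀ k : ℤ, ∀ x : A.nonpos, (x : L) ∈ A.piece k ↔ (e x : M) ∈ B.piece k
  parity : ∀ ε : ZMod 2, ∀ x : A.nonpos, (x : L) ∈ A.parity ε ↔ (e x : M) ∈ B.parity ε
  sq : ∀ x y : A.nonpos, (x : L) ∈ A.parity 1 → (y : L) = A.sq x → (e y : M) = B.sq (e x)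

end GradedLieSuperalgebra

namespace MethodTwo

section
attribute [local instance] LieRing.ofAssociativeRing

variable {K g : Type*} [Field K] [LieRing g] [LieAlgebra K g]

/-- The restricted closure (for `char K = 2`) of a Lie algebra without centre, which is identified
with its image under `ad`: the smallest Lie subalgebra of `End g` (whose 2-structure is
`f ↦ f²`) that contains `ad g` and is closed under squaring. -/
def restrictedClosure (K g : Type*) [Field K] [LieRing g] [LieAlgebra K g] :
    LieSubalgebra K (Module.End K g) :=
  sInf {M | (∀ x : g, LieAlgebra.ad K g x ∈ M) ∧ ∀ f ∈ M, f * f ∈ M}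

variable (A : LieGrading K g)

/-- The Lie algebra `(g, gr)`, where `gr` is the grading modulo 2: the smallest subalgebra (of the
restricted closure) that contains `g` and the squares `x^[2]` of all odd `x`. -/
def algebra : LieSubalgebra K (Module.End K g) :=
  LieSubalgebra.lieSpan K (Module.End K g)
    (Set.range (LieAlgebra.ad K g) ∪
      {f | ∃ x ∈ A.mod2 1, f = LieAlgebra.ad K g x * LieAlgebra.ad K g x})

theorem algebra_le_restrictedClosure : algebra A ≤ restrictedClosure K g := by
  refine LieSubalgebra.lieSpan_le.2 ?_
  intro f hf
  rw [restrictedClosure, LieSubalgebra.coe_sInf, Set.mem_iInter₂]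
  rintro M ⟨h1, h2⟩
  rcases hf with ⟨x, rfl⟩ | ⟨x, -, rfl⟩
  · exact h1 x
  · exact h2 _ (h1 x)

theorem ad_mem (x : g) : LieAlgebra.ad K g x ∈ algebra A :=
  LieSubalgebra.subset_lieSpan (Or.inl ⟨x, rfl⟩)

theorem ad_sq_mem {x : g} (hx : x ∈ A.mod2 1) :
    LieAlgebra.ad K g x * LieAlgebra.ad K g x ∈ algebra A :=
  LieSubalgebra.subset_lieSpan (Or.inr ⟨x, hx, rfl⟩)

/-- The endomorphisms of degree `k`. -/
def endPiece (k : ℤ) : Submodule K (Module.End K g) where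
  carrier := {f | ∀ j : ℤ, ∀ x ∈ A.piece j, f x ∈ A.piece (k + j)}
  add_mem' hf hg j x hx := add_mem (hf j x hx) (hg j x hx)
  zero_mem' j x _ := by simp
  smul_mem' a f hf j x hx := Submodule.smul_mem _ a (hf j x hx)

theorem ad_mem_endPiece {k : ℤ} {x : g} (hx : x ∈ A.piece k) :
    LieAlgebra.ad K g x ∈ endPiece A k :=
  fun _ _ hy => A.lie_mem hx hy

theorem mul_mem_endPiece {i j : ℤ} {f h : Module.End K g} (hf : f ∈ endPiece A i)
    (hh : h ∈ endPiece A j) : f * h ∈ endPiece A (i + j) := by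
  intro k x hx
  rw [add_assoc]
  exact hf _ _ (hh _ _ hx)

theorem lie_mem_endPiece {i j : ℤ} {f h : Module.End K g} (hf : f ∈ endPiece A i)
    (hh : h ∈ endPiece A j) : ⁅f, h⁆ ∈ endPiece A (i + j) := by
  rw [Ring.lie_def]
  refine sub_mem (mul_mem_endPiece A hf hh) ?_
  rw [add_comm i j]
  exact mul_mem_endPiece A hh hf

theorem endPiece_iSupIndep : iSupIndep (endPiece A) := by
  classical
  rw [iSupIndep_iff_forall_dfinsupp]
  intro i f v hv
  have key : ∀ j : ℤ, ∀ x ∈ A.piece j, (f : Module.End K g) x = 0 := by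
    intro j x hx
    have hind := A.isInternal.submodule_iSupIndep (i + j)
    rw [Submodule.disjoint_def] at hind
    refine hind _ (f.2 j x hx) ?_
    rw [← hv, DFinsupp.lsum_apply_apply, DFinsupp.sumAddHom_apply, DFinsupp.sum,
      LinearMap.sum_apply]
    refine Submodule.sum_mem _ fun k _ => ?_
    by_cases hk : k = i
    · subst hk; simp
    · refine Submodule.mem_iSup_of_mem (k + j) (Submodule.mem_iSup_of_mem (by omega) ?_)
      rw [DFinsupp.erase_ne hk]
      exact (v k).2 j x hx
  ext x
  have hx : x ∈ A.part Set.univ := by rw [A.part_univ]; trivial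
  exact A.part_induction (p := fun x => (f : Module.End K g) x = 0)
    (fun k _ x hx => key k x hx) (by simp)
    (fun x y hx hy => by rw [map_add, hx, hy, add_zero]) hx

/-- The component of degree `k` of `(g, gr)`. -/
def piece (k : ℤ) : Submodule K (algebra A) :=
  (endPiece A k).comap (algebra A).toSubmodule.subtype

theorem piece_iSupIndep : iSupIndep (piece A) := by
  intro i
  rw [Submodule.disjoint_def]
  intro x hx hx'
  have h := endPiece_iSupIndep A i
  rw [Submodule.disjoint_def] at h
  have h2 := Submodule.mem_map_of_mem (f := (algebra A).toSubmodule.subtype) hx'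
  have h3 : (x : Module.End K g) = 0 := by
    refine h _ hx ?_
    refine (?_ : Submodule.map _ _ ≤ _) h2
    simp only [Submodule.map_iSup]
    exact iSup₂_mono fun j _ => Submodule.map_comap_le _ _
  exact Subtype.ext h3

theorem add_self [CharP K 2] (f : Module.End K g) : f + f = 0 := by
  rw [← two_smul K f, CharTwo.two_eq_zero, zero_smul]

theorem add_mul_self [CharP K 2] (f h : Module.End K g) :
    (f + h) * (f + h) = f * f + h * h + ⁅f, h⁆ := by
  have h0 := add_self (h * f)
  rw [Ring.lie_def, ← add_zero (f * f + h * h + (f * h - h * f)), ← h0]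
  noncomm_ring

theorem lie_mul_self [CharP K 2] (f h : Module.End K g) : ⁅f * f, h⁆ = ⁅f, ⁅f, h⁆⁆ := by
  have h0 := add_self (f * h * f - h * f * f)
  simp only [Ring.lie_def]
  rw [← sub_eq_zero, ← h0]
  noncomm_ring

theorem iSup_piece [CharP K 2] : ⨆ k, piece A k = ⊤ := by
  let H : Submodule K (Module.End K g) := ⨆ k, endPiece A k ⊓ (algebra A).toSubmodule
  have hmem : ∀ k f, f ∈ endPiece A k → f ∈ algebra A → f ∈ H := fun k f h1 h2 =>
    Submodule.mem_iSup_of_mem k ⟨h1, h2⟩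
  have hlie : ∀ {f h : Module.End K g}, f ∈ H → h ∈ H → ⁅f, h⁆ ∈ H := by
    intro f h hf hh
    refine Submodule.iSup_induction (motive := fun f => ⁅f, h⁆ ∈ H) _ hf ?_ (by simp) ?_
    · intro i a ha
      refine Submodule.iSup_induction (motive := fun h => ⁅a, h⁆ ∈ H) _ hh ?_ (by simp) ?_
      · intro j b hb
        exact hmem (i + j) _ (lie_mem_endPiece A ha.1 hb.1) ((algebra A).lie_mem ha.2 hb.2)
      · intro b c hb hc
        rw [lie_add]; exact add_mem hb hc
    · intro a b ha hb
      rw [add_lie]; exact add_mem ha hb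
  have had : ∀ x : g, LieAlgebra.ad K g x ∈ H := by
    intro x
    have hx : x ∈ A.part Set.univ := by rw [A.part_univ]; trivial
    refine A.part_induction (p := fun x => LieAlgebra.ad K g x ∈ H) ?_ (by simp) ?_ hx
    · intro k _ x hx
      exact hmem k _ (ad_mem_endPiece A hx) (ad_mem A x)
    · intro x y hx hy
      rw [map_add]; exact add_mem hx hy
  have hsq : ∀ x ∈ A.mod2 1, LieAlgebra.ad K g x * LieAlgebra.ad K g x ∈ H := by
    intro x hx
    refine A.part_induction
      (p := fun x => LieAlgebra.ad K g x * LieAlgebra.ad K g x ∈ H) ?_ (by simp) ?_ hx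
    · intro k hk x hx
      exact hmem (k + k) _ (mul_mem_endPiece A (ad_mem_endPiece A hx) (ad_mem_endPiece A hx))
        (ad_sq_mem A (A.piece_le_part hk hx))
    · intro x y hx hy
      rw [map_add, add_mul_self, ← LieHom.map_lie]
      exact add_mem (add_mem hx hy) (had _)
  have hle : algebra A ≤ { H with lie_mem' := hlie } := by
    refine LieSubalgebra.lieSpan_le.2 ?_
    rintro f (⟨x, rfl⟩ | ⟨x, hx, rfl⟩)
    · exact had x
    · exact hsq x hx
  rw [eq_top_iff]
  rintro ⟨f, hf⟩ -
  have hfH : f ∈ H := hle hf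
  have hHle : H ≤ (⨆ k, piece A k).map (algebra A).toSubmodule.subtype := by
    refine iSup_le fun k => ?_
    rintro h ⟨h1, h2⟩
    exact ⟨⟨h, h2⟩, Submodule.mem_iSup_of_mem k h1, rfl⟩
  obtain ⟨y, hy, rfl⟩ := hHle hfH
  exact hy

/-- The `ℤ`-grading of `(g, gr)` that extends the one of `g`. -/
def grading [CharP K 2] : LieGrading K (algebra A) where
  piece := piece A
  isInternal := DirectSum.isInternal_submodule_of_iSupIndep_of_iSup_eq_top
    (piece_iSupIndep A) (iSup_piece A)
  lie_mem hx hy := lie_mem_endPiece A hx hy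

theorem apply_mem_mod2 {k : ℤ} {f : Module.End K g} (hf : f ∈ endPiece A k) {δ : ZMod 2} {x : g}
    (hx : x ∈ A.mod2 δ) : f x ∈ A.mod2 (k + δ) := by
  refine A.part_induction (p := fun x => f x ∈ A.mod2 (k + δ)) ?_ (by simp) ?_ hx
  · intro j hj x hx
    refine A.piece_le_part ?_ (hf j x hx)
    simp only [Set.mem_ofPred_eq] at *
    push_cast; rw [hj]
  · intro x y hx hy
    rw [map_add]; exact add_mem hx hy

theorem mod2_apply [CharP K 2] {ε δ : ZMod 2} {f : algebra A} (hf : f ∈ (grading A).mod2 ε)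
    {x : g} (hx : x ∈ A.mod2 δ) : (f : Module.End K g) x ∈ A.mod2 (ε + δ) := by
  refine (grading A).part_induction
    (p := fun f => (f : Module.End K g) x ∈ A.mod2 (ε + δ)) ?_ (by simp) ?_ hf
  · intro k hk f hf
    have := apply_mem_mod2 A (f := (f : Module.End K g)) hf hx
    rwa [show (k : ZMod 2) = ε from hk] at this
  · intro f h hf hh
    simpa using add_mem hf hh

theorem eq_zero_of_mod2 {f : Module.End K g}
    (h0 : ∀ δ, ∀ x ∈ A.mod2 δ, f x ∈ A.mod2 δ) (h1 : ∀ δ, ∀ x ∈ A.mod2 δ, f x ∈ A.mod2 (1 + δ)) :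
    f = 0 := by
  have hd := A.mod2_disjoint
  rw [Submodule.disjoint_def] at hd
  ext x
  obtain ⟨a, ha, b, hb, rfl⟩ := A.exists_mod2 x
  have h2 : (1 : ZMod 2) + 1 = 0 := by decide
  have ea : f a = 0 := hd _ (h0 _ _ ha) (by simpa using h1 _ _ ha)
  have eb : f b = 0 := hd _ (by simpa [h2] using h1 _ _ hb) (h0 _ _ hb)
  simp [ea, eb]

/-- An element of `(g, gr)` is the sum of an element of `g` and an even one. -/
theorem exists_ad_add [CharP K 2] {f : Module.End K g} (hf : f ∈ algebra A) :
    (∀ y, ⁅f, LieAlgebra.ad K g y⁆ = LieAlgebra.ad K g (f y)) ∧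
    ∃ x : g, ∀ δ, ∀ y ∈ A.mod2 δ, (f - LieAlgebra.ad K g x) y ∈ A.mod2 δ := by
  have hadd : ∀ x y : g, ⁅LieAlgebra.ad K g x, LieAlgebra.ad K g y⁆ =
      LieAlgebra.ad K g (LieAlgebra.ad K g x y) := by
    intro x y; rw [← LieHom.map_lie, LieAlgebra.ad_apply]
  have h2 : (1 : ZMod 2) + 1 = 0 := by decide
  let M : LieSubalgebra K (Module.End K g) :=
    { carrier := {f | (∀ y, ⁅f, LieAlgebra.ad K g y⁆ = LieAlgebra.ad K g (f y)) ∧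
        ∃ x : g, ∀ δ, ∀ y ∈ A.mod2 δ, (f - LieAlgebra.ad K g x) y ∈ A.mod2 δ}
      zero_mem' := ⟨by simp, 0, by simp⟩
      add_mem' := by
        rintro f h ⟨hf, x, hx⟩ ⟨hh, x', hx'⟩
        refine ⟨fun y => ?_, x + x', fun δ y hy => ?_⟩
        · rw [add_lie, hf, hh, LinearMap.add_apply, map_add]
        · have := add_mem (hx δ y hy) (hx' δ y hy)
          rw [← LinearMap.add_apply] at this
          rwa [map_add, add_sub_add_comm]
      smul_mem' := by
        rintro a f ⟨hf, x, hx⟩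
        refine ⟨fun y => ?_, a • x, fun δ y hy => ?_⟩
        · rw [smul_lie, hf, LinearMap.smul_apply, map_smul]
        · have := Submodule.smul_mem _ a (hx δ y hy)
          rw [← LinearMap.smul_apply] at this
          rwa [map_smul, ← smul_sub]
      lie_mem' := by
        rintro f h ⟨hf, x, hx⟩ ⟨hh, x', hx'⟩
        refine ⟨fun y => ?_, f x' - h x + ⁅x', x⁆, fun δ y hy => ?_⟩
        · rw [lie_lie, hh, hf, hf, hh, ← map_sub]; rfl
        · have e : ⁅f, h⁆ - LieAlgebra.ad K g (f x' - h x + ⁅x', x⁆) =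
              ⁅f - LieAlgebra.ad K g x, h - LieAlgebra.ad K g x'⁆ := by
            rw [map_add, map_sub, ← hf, ← hh, LieHom.map_lie]
            simp only [Ring.lie_def]
            noncomm_ring
          rw [e, Ring.lie_def]
          exact sub_mem (hx δ _ (hx' δ y hy)) (hx' δ _ (hx δ y hy)) }
  have hle : algebra A ≤ M := by
    refine LieSubalgebra.lieSpan_le.2 ?_
    rintro f (⟨x, rfl⟩ | ⟨x, hx, rfl⟩)
    · exact ⟨hadd x, x, by simp⟩
    · refine ⟨fun y => ?_, 0, fun δ y hy => ?_⟩
      · rw [lie_mul_self, hadd, hadd]; rfl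
      · have := A.lie_mem_mod2 hx (A.lie_mem_mod2 hx hy)
        rw [← add_assoc, h2, zero_add] at this
        simpa using this
  exact hle hf

/-- The odd part of `(g, gr)` is that of `g`. -/
theorem exists_ad_eq [CharP K 2] {f : algebra A} (hf : f ∈ (grading A).mod2 1) :
    ∃ x ∈ A.mod2 1, (f : Module.End K g) = LieAlgebra.ad K g x := by
  obtain ⟨-, x, hx⟩ := exists_ad_add A f.2
  obtain ⟨a, ha, b, hb, rfl⟩ := A.exists_mod2 x
  refine ⟨b, hb, sub_eq_zero.1 (eq_zero_of_mod2 A (fun δ y hy => ?_) (fun δ y hy => ?_))⟩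
  · have h1 := hx δ y hy
    have h2 := A.lie_mem_mod2 ha hy
    rw [zero_add] at h2
    have := add_mem h1 h2
    have e : (f : Module.End K g) y - ⁅a + b, y⁆ + ⁅a, y⁆ = (f : Module.End K g) y - ⁅b, y⁆ := by
      rw [add_lie]; abel
    change (f : Module.End K g) y - ⁅b, y⁆ ∈ _
    rw [← e]
    exact this
  · exact sub_mem (mod2_apply A hf hy) (A.lie_mem_mod2 hb hy)

theorem mul_self_mem [CharP K 2] {f : algebra A} (hf : f ∈ (grading A).mod2 1) :
    (f : Module.End K g) * (f : Module.End K g) ∈ algebra A := by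
  obtain ⟨x, hx, e⟩ := exists_ad_eq A hf
  rw [e]; exact ad_sq_mem A hx

open scoped Classical in
/-- The squaring of `S(g, gr)`: an odd `f` is sent to `f^[2]`. -/
noncomputable def sq (f : algebra A) : algebra A :=
  if h : (f : Module.End K g) * (f : Module.End K g) ∈ algebra A then ⟨_, h⟩ else 0

theorem coe_sq [CharP K 2] {f : algebra A} (hf : f ∈ (grading A).mod2 1) :
    (sq A f : Module.End K g) = (f : Module.End K g) * (f : Module.End K g) := by
  rw [sq, dif_pos (mul_self_mem A hf)]

theorem sq_mem [CharP K 2] {f : algebra A} (hf : f ∈ (grading A).mod2 1) :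
    sq A f ∈ (grading A).mod2 0 := by
  obtain ⟨a, ha, b, hb, e⟩ := (grading A).exists_mod2 (sq A f)
  have h2 : (1 : ZMod 2) + 1 = 0 := by decide
  have hb0 : (b : Module.End K g) = 0 := by
    refine eq_zero_of_mod2 A (fun δ y hy => ?_) (fun δ y hy => mod2_apply A hb hy)
    have e' : (b : Module.End K g) = (f : Module.End K g) * (f : Module.End K g) - a := by
      rw [← coe_sq A hf, e]; simp
    rw [e']
    have h3 := mod2_apply A hf (mod2_apply A hf hy)
    have h4 := mod2_apply A ha hy
    rw [← add_assoc, h2, zero_add] at h3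
    rw [zero_add] at h4
    exact sub_mem h3 h4
  have hb1 : b = 0 := Subtype.ext hb0
  rw [e, hb1, add_zero]; exact ha

end

end MethodTwo

section
attribute [local instance] LieRing.ofAssociativeRing

/-- The Lie superalgebra `S(g, gr)` obtained from `g` by method 2, where `gr` is the `ℤ`-grading
modulo 2: the space `(g, gr)` with the squaring `x ↦ x^[2]` of odd elements. -/
noncomputable def methodTwo {K g : Type*} [Field K] [CharP K 2] [LieRing g] [LieAlgebra K g]
    (A : LieGrading K g) : GradedLieSuperalgebra K (MethodTwo.algebra A) where
  toLieGrading := MethodTwo.grading A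
  parity := (MethodTwo.grading A).mod2
  parity_isInternal := (MethodTwo.grading A).mod2_isInternal
  lie_mem_parity := (MethodTwo.grading A).lie_mem_mod2
  piece_parity k := by
    refine le_antisymm ?_ (sup_le inf_le_left inf_le_left)
    have h2 : (k : ZMod 2) = 0 ∨ (k : ZMod 2) = 1 := by
      generalize (k : ZMod 2) = e; revert e; decide
    rcases h2 with h2 | h2
    · exact le_sup_of_le_left (le_inf le_rfl
        ((MethodTwo.grading A).piece_le_part (P := {k : ℤ | (k : ZMod 2) = 0}) h2))
    · exact le_sup_of_le_right (le_inf le_rfl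
        ((MethodTwo.grading A).piece_le_part (P := {k : ℤ | (k : ZMod 2) = 1}) h2))
  sq := MethodTwo.sq A
  sq_mem := MethodTwo.sq_mem A
  sq_mem_piece {k x} hx hk := by
    change (MethodTwo.sq A x : Module.End K g) ∈ MethodTwo.endPiece A (2 * k)
    rw [MethodTwo.coe_sq A hx, two_mul]
    exact MethodTwo.mul_mem_endPiece A hk hk
  sq_smul a x hx := by
    refine Subtype.ext ?_
    rw [MethodTwo.coe_sq A (Submodule.smul_mem _ a hx)]
    simp [MethodTwo.coe_sq A hx, pow_two, smul_smul]
  sq_add hx hy := by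
    refine Subtype.ext ?_
    rw [MethodTwo.coe_sq A (add_mem hx hy)]
    simpa [MethodTwo.coe_sq A hx, MethodTwo.coe_sq A hy] using MethodTwo.add_mul_self _ _
  sq_lie {x} y hx := by
    refine Subtype.ext ?_
    simpa [MethodTwo.coe_sq A hx] using MethodTwo.lie_mul_self (x : Module.End K g) y
end

/-! ### Linear maps on graded spaces. -/

namespace LieGrading

section
variable {K L M : Type*} [Field K] [LieRing L] [LieAlgebra K L] [LieRing M] [LieAlgebra K M]
  (A : LieGrading K L)

/-! Write S for S(g, gr). In degrees ≥ 0, S is no larger than g. In degree 0 no odd square is added,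
since 2j = 0 forces j = 0, which is even. An element f of S of degree k > 0 acts on g as a
derivation; the unconstrained prolong g contains some z acting like f on the negative part, and f -
ad z vanishes by transitivity. So only squares of odd elements of negative degree can be new
(`exists_ad_eq_of_nonneg`).

Let D be a derivation of degree k > 0 from the negative part of S to S. It sends ad of the component
of degree -1 into degree k - 1 ≥ 0, hence into ad g. That component generates the negative part of
g, and the bracket of S with ad g stays in ad g, so D sends all of ad g_- into ad g
(`derivation_adNeg_mem_range`). Thus D induces a derivation from g_- to g, given by some z because g
is a full prolong. The negative part of S is spanned by ad g_- and squares of odd elements of g_-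
(`mem_generatorPiece`, `eqOn_neg`), and D(x²) = [Dx, x] forces D = ad z on these squares too.

The universal property holds for any full prolong as target. An isomorphism of non-positive parts is
extended one degree at a time: for x of degree n + 1, the already known values of [x, y] with y
negative form a derivation of the target, which is bracketing with a unique z, the image of x
(`exists_bracket`, `exists_succ`). Transitivity of the target gives uniqueness and compatibility
with brackets, parity and squaring; transitivity of the source gives injectivity. If the source is
also a full prolong, extending the inverse isomorphism gives surjectivity. -/

theorem part_mono {P Q : Set ℤ} (h : P ⊆ Q) : A.part P ≤ A.part Q :=
  biSup_mono h

theorem mem_part_univ (x : L) : x ∈ A.part Set.univ := by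
  rw [A.part_univ]; trivial

theorem neg_le_nonpos {x : L} (hx : x ∈ A.neg) : x ∈ A.nonpos :=
  A.part_mono (fun k (hk : k < 0) => (hk.le : k ≤ 0)) hx

theorem mem_neg {k : ℤ} (hk : k < 0) {x : L} (hx : x ∈ A.piece k) : x ∈ A.neg :=
  A.piece_le_part (P := Set.Iio 0) hk hx

theorem mem_nonpos {k : ℤ} (hk : k ≤ 0) {x : L} (hx : x ∈ A.piece k) : x ∈ A.nonpos :=
  A.piece_le_part (P := Set.Iic 0) hk hx

/-- This drop in degree drives the inductions that use transitivity. -/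
theorem lie_neg_mem_part {k : ℤ} {x y : L} (hx : x ∈ A.piece (k + 1)) (hy : y ∈ A.neg) :
    ⁅x, y⁆ ∈ A.part (Set.Iic k) :=
  A.lie_mem_part (P := {k + 1}) (Q := Set.Iio 0) (by simp; omega)
    (A.piece_le_part (by simp) hx) hy

/-- A linear map may be prescribed on the homogeneous components. -/
theorem exists_linearMap_of_pieces {V : Type*} [AddCommGroup V] [Module K V]
    (θ : ℤ → L →ₗ[K] V) : ∃ φ : L →ₗ[K] V, ∀ k, ∀ x ∈ A.piece k, φ x = θ k x := by
  classical
  let E := LinearEquiv.ofBijective (DirectSum.coeLinearMap A.piece) A.isInternal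
  refine ⟨DirectSum.toModule K ℤ V (fun k => (θ k).domRestrict (A.piece k)) ∘ₗ
    E.symm.toLinearMap, fun k x hx => ?_⟩
  have h : E.symm x = DirectSum.lof K ℤ (fun k => A.piece k) k ⟨x, hx⟩ := by
    rw [LinearEquiv.symm_apply_eq]
    exact (DirectSum.coeLinearMap_lof A.piece k ⟨x, hx⟩).symm
  simp [h]

/-- A linear map that preserves degrees and is injective on homogeneous elements is injective. -/
theorem injective_of_pieces (B : LieGrading K M) (φ : L →ₗ[K] M)
    (hφ : ∀ k, ∀ x ∈ A.piece k, φ x ∈ B.piece k)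
    (hinj : ∀ k, ∀ x ∈ A.piece k, φ x = 0 → x = 0) : Function.Injective φ := by
  classical
  rw [← LinearMap.ker_eq_bot, LinearMap.ker_eq_bot']
  intro x hx
  obtain ⟨v, rfl⟩ := A.isInternal.2 x
  have h1 : DirectSum.coeLinearMap B.piece
      (DirectSum.lmap (fun k => φ.restrict (hφ k)) v) = φ (DirectSum.coeLinearMap A.piece v) := by
    rw [← LinearMap.comp_apply, ← LinearMap.comp_apply]
    congr 1
    ext k y
    simp
  have h2 : DirectSum.lmap (fun k => φ.restrict (hφ k)) v = 0 := by
    apply B.isInternal.1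
    rw [map_zero]
    exact h1.trans hx
  have h3 : v = 0 := by
    ext k
    have := DFunLike.congr_fun h2 k
    rw [DirectSum.lmap_apply, DirectSum.zero_apply] at this
    have := hinj k _ (v k).2 (by simpa using congrArg Subtype.val this)
    simpa using this
  simp [h3]

end

end LieGrading

/-! ### Parity, squares and isomorphisms of non-positive parts. -/

namespace GradedLieSuperalgebra

variable {K L M : Type*} [Field K] [LieRing L] [LieAlgebra K L] [LieRing M] [LieAlgebra K M]
  {A : GradedLieSuperalgebra K L} {B : GradedLieSuperalgebra K M}
  {e : A.nonpos ≃ₗ⁅K⁆ B.nonpos}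

theorem parity_disjoint (A : GradedLieSuperalgebra K L) {i j : ZMod 2} (h : i ≠ j) :
    Disjoint (A.parity i) (A.parity j) :=
  A.parity_isInternal.submodule_iSupIndep.pairwiseDisjoint h

theorem mem_piece_induction (A : GradedLieSuperalgebra K L) {k : ℤ} {p : L → Prop}
    (hmem : ∀ ε, ∀ x ∈ A.piece k, x ∈ A.parity ε → p x)
    (hadd : ∀ x y, p x → p y → p (x + y)) {x : L} (hx : x ∈ A.piece k) : p x := by
  rw [A.piece_parity, Submodule.mem_sup] at hx
  obtain ⟨a, ha, b, hb, rfl⟩ := hx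
  exact hadd _ _ (hmem 0 a ha.1 ha.2) (hmem 1 b hb.1 hb.2)

/-- The part of given degrees is the sum of its even and its odd part. -/
theorem part_parity (A : GradedLieSuperalgebra K L) (P : Set ℤ) (ε : ZMod 2) {x : L}
    (hx : x ∈ A.part P) (hε : x ∈ A.parity ε) :
    x ∈ ⨆ k ∈ P, A.piece k ⊓ A.parity ε := by
  have h01 : ε ≠ 1 + ε := by clear hε; revert ε; decide
  have key : ∃ a b, x = a + b ∧ a ∈ (⨆ k ∈ P, A.piece k ⊓ A.parity ε) ∧ b ∈ A.parity (1 + ε) := by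
    refine A.part_induction (p := fun x => ∃ a b, x = a + b ∧
      a ∈ (⨆ k ∈ P, A.piece k ⊓ A.parity ε) ∧ b ∈ A.parity (1 + ε)) ?_ ?_ ?_ hx
    · intro k hk x hx
      refine A.mem_piece_induction (p := fun x => ∃ a b, x = a + b ∧
        a ∈ (⨆ k ∈ P, A.piece k ⊓ A.parity ε) ∧ b ∈ A.parity (1 + ε)) ?_ ?_ hx
      · intro δ x hx hδ
        have hd : δ = ε ∨ δ = 1 + ε := by clear hδ hε h01; revert δ ε; decide
        rcases hd with rfl | rfl
        · exact ⟨x, 0, by simp, Submodule.mem_iSup_of_mem k (Submodule.mem_iSup_of_mem hk ⟨hx, hδ⟩),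
            zero_mem _⟩
        · exact ⟨0, x, by simp, zero_mem _, hδ⟩
      · rintro _ _ ⟨a, b, rfl, ha, hb⟩ ⟨c, d, rfl, hc, hd⟩
        exact ⟨a + c, b + d, by abel, add_mem ha hc, add_mem hb hd⟩
    · exact ⟨0, 0, by simp, zero_mem _, zero_mem _⟩
    · rintro _ _ ⟨a, b, rfl, ha, hb⟩ ⟨c, d, rfl, hc, hd⟩
      exact ⟨a + c, b + d, by abel, add_mem ha hc, add_mem hb hd⟩
  obtain ⟨a, b, rfl, ha, hb⟩ := key
  have ha' : a ∈ A.parity ε :=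
    (iSup₂_le fun k _ => inf_le_right : (⨆ k ∈ P, A.piece k ⊓ A.parity ε) ≤ A.parity ε) ha
  have hb' : b ∈ A.parity ε := by simpa using sub_mem hε ha'
  rw [Submodule.disjoint_def.1 (A.parity_disjoint h01) b hb' hb, add_zero]
  exact ha

/-- The additive step keeps the parity of both summands, because `sq_add` is available for odd
elements only. -/
theorem part_parity_induction (A : GradedLieSuperalgebra K L) {P : Set ℤ} {ε : ZMod 2}
    {p : L → Prop} (hmem : ∀ k ∈ P, ∀ x ∈ A.piece k, x ∈ A.parity ε → p x) (h0 : p 0)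
    (hadd : ∀ x y, x ∈ A.parity ε → y ∈ A.parity ε → p x → p y → p (x + y))
    {x : L} (hx : x ∈ A.part P) (hε : x ∈ A.parity ε) : p x := by
  refine (Submodule.iSup_induction (motive := fun x => x ∈ A.parity ε ∧ p x)
    (fun k => ⨆ (_ : k ∈ P), A.piece k ⊓ A.parity ε) (A.part_parity P ε hx hε)
    ?_ ⟨zero_mem _, h0⟩ ?_).2
  · intro k y hy
    by_cases hk : k ∈ P
    · have hy' : y ∈ A.piece k ⊓ A.parity ε := by simpa [hk] using hy
      exact ⟨hy'.2, hmem k hk y hy'.1 hy'.2⟩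
    · have : y = 0 := by simpa [hk] using hy
      exact this ▸ ⟨zero_mem _, h0⟩
  · rintro x y ⟨hx, px⟩ ⟨hy, py⟩
    exact ⟨add_mem hx hy, hadd x y hx hy px py⟩

theorem sq_zero (A : GradedLieSuperalgebra K L) : A.sq 0 = 0 := by
  simpa using A.sq_smul 0 (zero_mem (A.parity 1))

/-- This is the rule D(x²) = [Dx, x] for the inner derivation D = ad y; the signs disappear in
characteristic 2. -/
theorem lie_sq [CharP K 2] (A : GradedLieSuperalgebra K L) {x : L} (y : L)
    (hx : x ∈ A.parity 1) : ⁅y, A.sq x⁆ = ⁅⁅y, x⁆, x⁆ := by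
  rw [← lie_skew, A.sq_lie y hx, ← lie_skew x y, lie_neg, neg_neg, ← lie_skew ⁅y, x⁆ x,
    ← neg_one_smul K ⁅x, ⁅y, x⁆⁆, CharTwo.neg_eq, one_smul]

/-- The square of a sum of homogeneous odd elements consists of their squares and mutual brackets.
-/
theorem sq_mem_part (A : GradedLieSuperalgebra K L) {P : Set ℤ} (hP : ∀ i ∈ P, ∀ j ∈ P, i + j ∈ P)
    {x : L} (hx : x ∈ A.part P) (h1 : x ∈ A.parity 1) : A.sq x ∈ A.part P := by
  refine (A.part_parity_induction (p := fun x => x ∈ A.part P ∧ A.sq x ∈ A.part P)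
    ?_ ?_ ?_ hx h1).2
  · intro k hk x hx h1
    refine ⟨A.piece_le_part hk hx, A.piece_le_part ?_ (A.sq_mem_piece h1 hx)⟩
    rw [two_mul]; exact hP k hk k hk
  · simp [A.sq_zero]
  · rintro x y hx hy ⟨px, qx⟩ ⟨py, qy⟩
    refine ⟨add_mem px py, ?_⟩
    rw [A.sq_add hx hy]
    exact add_mem (add_mem qx qy) (A.lie_mem_part hP px py)

namespace IsNonposIso

theorem apply_mem_neg (he : A.IsNonposIso B e) {x : A.nonpos} (hx : (x : L) ∈ A.neg) :
    (e x : M) ∈ B.neg := by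
  have : ∃ h : (x : L) ∈ A.nonpos, (e ⟨x, h⟩ : M) ∈ B.neg := by
    refine A.part_induction (P := Set.Iio 0)
      (p := fun y => ∃ h : y ∈ A.nonpos, (e ⟨y, h⟩ : M) ∈ B.neg) ?_ ?_ ?_ hx
    · intro k hk y hy
      exact ⟨A.mem_nonpos (le_of_lt hk) hy, B.mem_neg hk ((he.piece k ⟨y, _⟩).1 hy)⟩
    · exact ⟨zero_mem _, by
        rw [show (⟨0, zero_mem _⟩ : A.nonpos) = 0 from rfl, map_zero]; exact zero_mem _⟩
    · rintro y z ⟨hy, hy'⟩ ⟨hz, hz'⟩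
      refine ⟨add_mem hy hz, ?_⟩
      rw [show (⟨y + z, add_mem hy hz⟩ : A.nonpos) = ⟨y, hy⟩ + ⟨z, hz⟩ from rfl, map_add]
      exact add_mem hy' hz'
  exact this.2

/-- Only the squaring needs an argument: the square of the preimage must be known to be non-positive
before `e` can be applied to it. -/
theorem symm (he : A.IsNonposIso B e) : B.IsNonposIso A e.symm where
  piece k x := by rw [he.piece k, LieEquiv.apply_symm_apply]
  parity ε x := by rw [he.parity ε, LieEquiv.apply_symm_apply]
  sq x y hx hy := by
    have hx' : (e.symm x : L) ∈ A.parity 1 := by rwa [he.parity, LieEquiv.apply_symm_apply]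
    have hmem : A.sq (e.symm x) ∈ A.nonpos :=
      A.sq_mem_part (P := Set.Iic 0) (fun i hi j hj => by simp only [Set.mem_Iic] at *; omega)
        (e.symm x).2 hx'
    have h := he.sq (e.symm x) ⟨_, hmem⟩ hx' rfl
    rw [LieEquiv.apply_symm_apply, ← hy] at h
    rw [← Subtype.ext h, LieEquiv.symm_apply_apply]

end IsNonposIso

/-! ### Degree-by-degree extension into a full prolong. -/

/-- A linear map extends `e`, and up to degree `n` it preserves degrees and commutes with the
brackets with negative elements. -/
structure IsPartialExtension (A : GradedLieSuperalgebra K L) (B : GradedLieSuperalgebra K M)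
    (e : A.nonpos ≃ₗ⁅K⁆ B.nonpos) (n : ℤ) (φ : L →ₗ[K] M) : Prop where
  apply : ∀ x : A.nonpos, φ x = e x
  piece : ∀ k ≤ n, ∀ x ∈ A.piece k, φ x ∈ B.piece k
  lie : ∀ k ≤ n, ∀ x ∈ A.piece k, ∀ y ∈ A.neg, φ ⁅x, y⁆ = ⁅φ x, φ y⁆

namespace IsPartialExtension

theorem mono {m n : ℤ} (h : m ≤ n) {φ : L →ₗ[K] M} (hφ : IsPartialExtension A B e n φ) :
    IsPartialExtension A B e m φ :=
  ⟨hφ.apply, fun k hk => hφ.piece k (hk.trans h), fun k hk => hφ.lie k (hk.trans h)⟩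

theorem lie_part {n : ℤ} {φ : L →ₗ[K] M} (hφ : IsPartialExtension A B e n φ) {x : L}
    (hx : x ∈ A.part (Set.Iic n)) {y : L} (hy : y ∈ A.neg) : φ ⁅x, y⁆ = ⁅φ x, φ y⁆ := by
  refine A.part_induction (p := fun x => φ ⁅x, y⁆ = ⁅φ x, φ y⁆)
    (fun k hk x hx => hφ.lie k hk x hx y hy) (by simp) ?_ hx
  intro a b ha hb
  rw [add_lie, map_add, ha, hb, map_add, add_lie]

/-- By transitivity an element of degree `≥ 0` is determined by its brackets with the images of
the negative elements. -/
theorem eq_zero_of_lie {n : ℤ} {φ : L →ₗ[K] M} (hφ : IsPartialExtension A B e n φ)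
    (he : A.IsNonposIso B e) (hB : B.IsTransitive) {k : ℤ} (hk : 0 ≤ k) {z : M}
    (hz : z ∈ B.piece k) (h : ∀ y ∈ A.neg, ⁅z, φ y⁆ = 0) : z = 0 := by
  refine hB k hk z hz fun y hy => ?_
  have h1 := h _ (he.symm.apply_mem_neg (x := ⟨y, B.neg_le_nonpos hy⟩) hy)
  rwa [hφ.apply, LieEquiv.apply_symm_apply] at h1

/-- In the first degree where two extensions could differ, the difference at x commutes with the
negative part, since [x, y] has lower degree; transitivity kills it. -/
theorem eqOn (he : A.IsNonposIso B e) (hB : B.IsTransitive) {n : ℤ} {φ ψ : L →ₗ[K] M}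
    (hφ : IsPartialExtension A B e n φ) (hψ : IsPartialExtension A B e n ψ) {x : L}
    (hx : x ∈ A.part (Set.Iic n)) : φ x = ψ x := by
  have hnp : ∀ x ∈ A.nonpos, φ x = ψ x := fun x hx =>
    (hφ.apply ⟨x, hx⟩).trans (hψ.apply ⟨x, hx⟩).symm
  have key : ∀ m : ℕ, (m : ℤ) ≤ n → ∀ x ∈ A.part (Set.Iic (m : ℤ)), φ x = ψ x := by
    intro m
    induction m with
    | zero => exact fun _ x hx => hnp x hx
    | succ m ih =>
      intro hm x hx
      refine A.part_induction (p := fun x => φ x = ψ x) ?_ (by simp) ?_ hx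
      · intro k hk x hx
        rcases (show k ≤ (m : ℤ) + 1 by simpa using hk).lt_or_eq with hk | rfl
        · exact ih (by push_cast at hm; omega) x
            (A.piece_le_part (P := Set.Iic (m : ℤ)) (Set.mem_Iic.2 (by omega)) hx)
        · push_cast at hm
          rw [← sub_eq_zero]
          refine hφ.eq_zero_of_lie he hB (by omega)
            (sub_mem (hφ.piece _ hm x hx) (hψ.piece _ hm x hx)) fun y hy => ?_
          rw [sub_lie, ← hφ.lie _ hm x hx y hy, hnp y (A.neg_le_nonpos hy),
            ← hψ.lie _ hm x hx y hy, sub_eq_zero]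
          exact ih (by omega) _ (A.lie_neg_mem_part hx hy)
      · intro x y hx hy
        rw [map_add, hx, hy, map_add]
  by_cases hn : 0 ≤ n
  · lift n to ℕ using hn
    exact key n le_rfl x hx
  · exact hnp x (A.part_mono (Set.Iic_subset_Iic.2 (by omega)) hx)

/-- The values in positive degree are arbitrary here; later stages overwrite them. -/
theorem exists_base (he : A.IsNonposIso B e) : ∃ φ, IsPartialExtension A B e 0 φ := by
  obtain ⟨φ, hφ⟩ := LinearMap.exists_extend
    (B.nonpos.toSubmodule.subtype ∘ₗ (e.toLinearEquiv : A.nonpos →ₗ[K] B.nonpos))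
  have h : ∀ x : A.nonpos, φ x = e x := fun x => LinearMap.congr_fun hφ x
  refine ⟨φ, h, fun k hk x hx => ?_, fun k hk x hx y hy => ?_⟩
  · have hx' := A.mem_nonpos hk hx
    rw [h ⟨x, hx'⟩]
    exact (he.piece k ⟨x, hx'⟩).1 hx
  · have hx' := A.mem_nonpos hk hx
    have hy' := A.neg_le_nonpos hy
    have := h ⁅(⟨x, hx'⟩ : A.nonpos), ⟨y, hy'⟩⁆
    rw [LieEquiv.map_lie] at this
    rw [h ⟨x, hx'⟩, h ⟨y, hy'⟩]
    exact this

/-- The map t ↦ φ[x, e⁻¹t] is a derivation of degree n + 1 on the negative part of the target, so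
fullness makes it inner; z is the candidate image of x. -/
theorem exists_bracket [CharP K 2] (he : A.IsNonposIso B e) (hB : B.IsFullProlong) {n : ℤ}
    (hn : 0 ≤ n) {φ : L →ₗ[K] M} (hφ : IsPartialExtension A B e n φ) {x : L}
    (hx : x ∈ A.piece (n + 1)) :
    ∃ z ∈ B.piece (n + 1), ∀ y ∈ A.neg, ⁅z, φ y⁆ = φ ⁅x, y⁆ := by
  have hmem : ∀ t : B.neg, (e.symm ⟨t, B.neg_le_nonpos t.2⟩ : L) ∈ A.neg := fun t =>
    he.symm.apply_mem_neg (x := ⟨t, B.neg_le_nonpos t.2⟩) t.2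
  have happ : ∀ t : B.neg, φ (e.symm ⟨t, B.neg_le_nonpos t.2⟩ : L) = t := fun t => by
    rw [hφ.apply, LieEquiv.apply_symm_apply]
  -- The element [x, s] has degree at most n, where φ already respects brackets with negative
  -- elements.
  have hlie : ∀ (s : L), s ∈ A.neg → ∀ t : B.neg, φ ⁅⁅x, s⁆, (e.symm ⟨t, B.neg_le_nonpos t.2⟩ : L)⁆ =
      ⁅φ ⁅x, s⁆, (t : M)⁆ := fun s hs t => by
    rw [hφ.lie_part (A.lie_neg_mem_part hx hs) (hmem t), happ]
  let D : LieDerivation K B.neg M :=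
    { toFun := fun t => φ ⁅x, (e.symm ⟨t, B.neg_le_nonpos t.2⟩ : L)⁆
      map_add' := fun s t => by
        have h : e.symm ⟨(s + t : B.neg), B.neg_le_nonpos (s + t : B.neg).2⟩ =
            e.symm ⟨s, B.neg_le_nonpos s.2⟩ + e.symm ⟨t, B.neg_le_nonpos t.2⟩ :=
          map_add e.symm ⟨s, B.neg_le_nonpos s.2⟩ ⟨t, B.neg_le_nonpos t.2⟩
        rw [h, AddMemClass.coe_add, lie_add, map_add]
      map_smul' := fun a t => by
        have h : e.symm ⟨(a • t : B.neg), B.neg_le_nonpos (a • t : B.neg).2⟩ =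
            a • e.symm ⟨t, B.neg_le_nonpos t.2⟩ :=
          map_smul e.symm a ⟨t, B.neg_le_nonpos t.2⟩
        rw [h, SetLike.val_smul, lie_smul, map_smul, RingHom.id_apply]
      leibniz' := fun s t => by
        have h : e.symm ⟨(⁅s, t⁆ : B.neg), B.neg_le_nonpos (⁅s, t⁆ : B.neg).2⟩ =
            ⁅e.symm ⟨s, B.neg_le_nonpos s.2⟩, e.symm ⟨t, B.neg_le_nonpos t.2⟩⁆ := by
          rw [← LieEquiv.map_lie]; rfl
        change φ ⁅x, _⁆ = ⁅(s : M), φ _⁆ - ⁅(t : M), φ _⁆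
        rw [h, LieSubalgebra.coe_bracket, leibniz_lie, map_add, hlie _ (hmem s),
          ← lie_skew (e.symm ⟨s, B.neg_le_nonpos s.2⟩ : L), map_neg, hlie _ (hmem t),
          ← lie_skew (s : M), ← lie_skew (t : M)]
        abel }
  have hD : ∀ t : B.neg, D t = φ ⁅x, (e.symm ⟨t, B.neg_le_nonpos t.2⟩ : L)⁆ := fun t => rfl
  have hsq : ∀ s t : B.neg, (s : M) ∈ B.parity 1 → (t : M) = B.sq s → D t = ⁅D s, (s : M)⁆ := by
    intro s t hs hst
    have hs' : (e.symm ⟨s, B.neg_le_nonpos s.2⟩ : L) ∈ A.parity 1 :=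
      (he.symm.parity 1 _).1 hs
    rw [hD, hD, he.symm.sq ⟨s, B.neg_le_nonpos s.2⟩ ⟨t, B.neg_le_nonpos t.2⟩ hs hst,
      ← hlie _ (hmem s) s, A.lie_sq x hs']
  have hdeg : ∀ j : ℤ, ∀ t : B.neg, (t : M) ∈ B.piece j → D t ∈ B.piece (j + (n + 1)) := by
    intro j t ht
    have h := (he.symm.piece j ⟨t, B.neg_le_nonpos t.2⟩).1 ht
    rw [hD]
    by_cases h0 : j < 0
    · rw [add_comm]
      exact hφ.piece _ (by omega) _ (A.lie_mem hx h)
    -- A negative element that also has degree j ≥ 0 is zero.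
    · have hd : Disjoint (B.piece j) (B.part (Set.Iio 0)) := by
        have := B.isInternal.submodule_iSupIndep.disjoint_biSup (x := j) (y := Set.Iio (0 : ℤ)) h0
        exact this
      have ht0 : (⟨t, B.neg_le_nonpos t.2⟩ : B.nonpos) = 0 :=
        Subtype.ext (Submodule.disjoint_def.1 hd _ ht t.2)
      rw [ht0]
      simp
  obtain ⟨z, hz, hzD⟩ := hB.2 (n + 1) (by omega) D hsq hdeg
  refine ⟨z, hz, fun y hy => ?_⟩
  have hy' := A.neg_le_nonpos hy
  have h := hzD ⟨_, he.apply_mem_neg (x := ⟨y, hy'⟩) hy⟩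
  rw [hD, Subtype.coe_eta, LieEquiv.symm_apply_apply, ← hφ.apply] at h
  exact h.symm

/-- The chosen z is unique by transitivity, so it depends linearly on x and can redefine φ in degree
n + 1. -/
theorem exists_succ [CharP K 2] (he : A.IsNonposIso B e) (hB : B.IsFullProlong) {n : ℤ}
    (hn : 0 ≤ n) {φ : L →ₗ[K] M} (hφ : IsPartialExtension A B e n φ) :
    ∃ ψ, IsPartialExtension A B e (n + 1) ψ := by
  choose z hz hzφ using fun x : A.piece (n + 1) => hφ.exists_bracket he hB hn x.2
  have huniq : ∀ (a : M) (b : M), a ∈ B.piece (n + 1) → b ∈ B.piece (n + 1) →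
      (∀ y ∈ A.neg, ⁅a, φ y⁆ = ⁅b, φ y⁆) → a = b := fun a b ha hb h => by
    rw [← sub_eq_zero]
    exact hφ.eq_zero_of_lie he hB.1 (by omega) (sub_mem ha hb)
      fun y hy => by rw [sub_lie, h y hy, sub_self]
  let ζ : A.piece (n + 1) →ₗ[K] M :=
    { toFun := z
      map_add' := fun x y => huniq _ _ (hz _) (add_mem (hz x) (hz y)) fun t ht => by
        simp [add_lie, hzφ _ t ht]
      map_smul' := fun a x => huniq _ _ (hz _) (Submodule.smul_mem _ a (hz x)) fun t ht => by
        simp [smul_lie, hzφ _ t ht] }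
  obtain ⟨ζ', hζ'⟩ := LinearMap.exists_extend ζ
  have hζ : ∀ x (hx : x ∈ A.piece (n + 1)), ζ' x = z ⟨x, hx⟩ := fun x hx =>
    LinearMap.congr_fun hζ' ⟨x, hx⟩
  obtain ⟨ψ, hψ⟩ := A.exists_linearMap_of_pieces (fun k => if k = n + 1 then ζ' else φ)
  have h1 : ∀ x (hx : x ∈ A.piece (n + 1)), ψ x = z ⟨x, hx⟩ := fun x hx => by
    rw [hψ _ x hx, if_pos rfl, hζ]
  have h2 : ∀ x ∈ A.part (Set.Iic n), ψ x = φ x := fun x hx => by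
    refine A.part_induction (p := fun x => ψ x = φ x) ?_ (by simp) ?_ hx
    · intro k hk x hx
      rw [hψ k x hx, if_neg (by simp only [Set.mem_Iic] at hk; omega)]
    · intro x y hx hy
      rw [map_add, map_add, hx, hy]
  have h3 : ∀ x ∈ A.nonpos, ψ x = φ x := fun x hx =>
    h2 x (A.part_mono (Set.Iic_subset_Iic.2 hn) hx)
  refine ⟨ψ, fun x => by rw [h3 x x.2, hφ.apply], fun k hk x hx => ?_, fun k hk x hx y hy => ?_⟩
  · rcases hk.lt_or_eq with hk | rfl
    · rw [h2 x (A.piece_le_part (Set.mem_Iic.2 (by omega)) hx)]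
      exact hφ.piece k (by omega) x hx
    · rw [h1 x hx]; exact hz _
  · rw [h3 y (A.neg_le_nonpos hy)]
    rcases hk.lt_or_eq with hk | rfl
    · have hk' : k ≤ n := by omega
      rw [h2 x (A.piece_le_part (Set.mem_Iic.2 hk') hx), ← hφ.lie k hk' x hx y hy]
      refine h2 _ (A.lie_mem_part (P := Set.Iic n) (Q := Set.Iio 0) ?_
        (A.piece_le_part (Set.mem_Iic.2 hk') hx) hy)
      intro i hi j hj
      simp only [Set.mem_Iic, Set.mem_Iio] at *
      omega
    · rw [h1 x hx, hzφ _ y hy]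
      exact h2 _ (A.lie_neg_mem_part hx hy)

theorem exists_of_le [CharP K 2] (he : A.IsNonposIso B e) (hB : B.IsFullProlong) (n : ℕ) :
    ∃ φ, IsPartialExtension A B e n φ := by
  induction n with
  | zero => exact exists_base he
  | succ n ih =>
    obtain ⟨φ, hφ⟩ := ih
    exact_mod_cast hφ.exists_succ he hB (by omega)

theorem exists_forall [CharP K 2] (he : A.IsNonposIso B e) (hB : B.IsFullProlong) :
    ∃ φ, ∀ n, IsPartialExtension A B e n φ := by
  choose φ hφ using fun n => exists_of_le (n := n) he hB
  -- In degree k the stage `k.toNat` is used, which is stage 0 for k ≤ 0. The stages are chosen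
  -- independently; `eqOn` makes them agree wherever both are valid.
  obtain ⟨ψ, hψ⟩ := A.exists_linearMap_of_pieces (fun k => φ k.toNat)
  have key : ∀ n : ℕ, ∀ x ∈ A.part (Set.Iic (n : ℤ)), ψ x = φ n x := fun n x hx => by
    refine A.part_induction (p := fun x => ψ x = φ n x) ?_ (by simp) ?_ hx
    · intro k hk x hx
      simp only [Set.mem_Iic] at hk
      rw [hψ k x hx]
      exact (hφ k.toNat).eqOn he hB.1 ((hφ n).mono (by omega))
        (A.piece_le_part (Set.mem_Iic.2 (by omega)) hx)
    · intro x y hx hy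
      rw [map_add, map_add, hx, hy]
  have h3 : ∀ n : ℕ, ∀ x ∈ A.nonpos, ψ x = φ n x := fun n x hx =>
    key n x (A.part_mono (Set.Iic_subset_Iic.2 (by omega)) hx)
  refine ⟨ψ, fun n => ⟨fun x => by rw [h3 0 x x.2, (hφ 0).apply], fun k hk x hx => ?_,
    fun k hk x hx y hy => ?_⟩⟩
  · rw [hψ k x hx]
    exact (hφ _).piece k (by omega) x hx
  · have hk' : k ≤ k.toNat := by omega
    rw [h3 k.toNat y (A.neg_le_nonpos hy), hψ k x hx, ← (hφ _).lie k hk' x hx y hy]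
    refine key _ _ (A.lie_mem_part (P := {k}) (Q := Set.Iio 0) ?_
        (A.piece_le_part (Set.mem_singleton k) hx) hy)
    intro i hi j hj
    simp only [Set.mem_Iic, Set.mem_Iio, Set.mem_singleton_iff] at *
    omega

end IsPartialExtension
end GradedLieSuperalgebra
-- The extension as a homomorphism: uniqueness, injectivity, surjectivity.
namespace GradedLieSuperalgebra

variable {K L M : Type*} [Field K] [LieRing L] [LieAlgebra K L] [LieRing M] [LieAlgebra K M]
  {A : GradedLieSuperalgebra K L} {B : GradedLieSuperalgebra K M}
  {e : A.nonpos ≃ₗ⁅K⁆ B.nonpos}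

/-- The bracket of the wrong-parity part of z with a negative element of pure parity lies in both
parities, so it is zero and transitivity removes that part. -/
theorem mem_parity_of_lie (hB : B.IsTransitive) {k : ℤ} (hk : 0 ≤ k) {ε : ZMod 2} {z : M}
    (hz : z ∈ B.piece k)
    (h : ∀ δ, ∀ y ∈ B.neg, y ∈ B.parity δ → ⁅z, y⁆ ∈ B.parity (ε + δ)) : z ∈ B.parity ε := by
  have h01 : ε ≠ 1 + ε := by clear h; revert ε; decide
  have hz' : ∃ a b, z = a + b ∧ (a ∈ B.piece k ∧ a ∈ B.parity ε) ∧
      b ∈ B.piece k ∧ b ∈ B.parity (1 + ε) := by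
    have hd : ε = 0 ∨ ε = 1 := by clear h h01; revert ε; decide
    have := hz
    rw [B.piece_parity, Submodule.mem_sup] at this
    obtain ⟨a, ha, b, hb, rfl⟩ := this
    rcases hd with rfl | rfl
    · exact ⟨a, b, rfl, ha, hb⟩
    · exact ⟨b, a, add_comm _ _, hb, ha⟩
  obtain ⟨a, b, rfl, ⟨-, ha⟩, hbk, hb⟩ := hz'
  have hb0 : b = 0 := by
    refine hB k hk b hbk fun y hy => ?_
    refine B.part_induction (P := Set.Iio 0) (p := fun y => ⁅b, y⁆ = 0) ?_ (by simp) ?_ hy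
    · intro j hj y hy
      refine B.mem_piece_induction (p := fun y => ⁅b, y⁆ = 0) ?_ ?_ hy
      · intro δ y hy hδ
        have h1 : ⁅b, y⁆ ∈ B.parity (ε + δ) := by
          have := sub_mem (h δ y (B.mem_neg hj hy) hδ) (B.lie_mem_parity ha hδ)
          rwa [add_lie, add_sub_cancel_left] at this
        exact Submodule.disjoint_def.1
          (B.parity_disjoint fun h => h01 (add_right_cancel h)) _ h1 (B.lie_mem_parity hb hδ)
      · intro x y hx hy
        rw [lie_add, hx, hy, add_zero]
    · intro x y hx hy
      rw [lie_add, hx, hy, add_zero]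
  rw [hb0, add_zero]; exact ha

namespace IsPartialExtension

variable {φ : L →ₗ[K] M}

/-- Induction on the total degree i + j: bracketing the defect with a negative t and using Jacobi
leaves brackets of lower total degree. -/
theorem map_lie (he : A.IsNonposIso B e) (hB : B.IsTransitive)
    (hφ : ∀ n, IsPartialExtension A B e n φ) (x y : L) : φ ⁅x, y⁆ = ⁅φ x, φ y⁆ := by
  have hneg : ∀ x : L, ∀ y ∈ A.neg, φ ⁅x, y⁆ = ⁅φ x, φ y⁆ := fun x y hy =>
    A.part_induction (p := fun x => φ ⁅x, y⁆ = ⁅φ x, φ y⁆)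
      (fun k _ x hx => (hφ k).lie k le_rfl x hx y hy) (by simp)
      (fun a b ha hb => by rw [add_lie, map_add, ha, hb, map_add, add_lie]) (A.mem_part_univ x)
  have hneg' : ∀ x ∈ A.neg, ∀ y, φ ⁅x, y⁆ = ⁅φ x, φ y⁆ := fun x hx y => by
    rw [← lie_skew, map_neg, hneg y x hx, lie_skew]
  have key : ∀ n : ℕ, ∀ i j : ℤ, i + j < n → ∀ x ∈ A.piece i, ∀ y ∈ A.piece j,
      φ ⁅x, y⁆ = ⁅φ x, φ y⁆ := by
    intro n
    induction n with
    -- If i + j < 0, one of the two degrees is negative, and brackets with negative elements are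
    -- already respected.
    | zero =>
      intro i j hij x hx y hy
      by_cases hi : i < 0
      · exact hneg' x (A.mem_neg hi hx) y
      · exact hneg x y (A.mem_neg (by push_cast at hij; omega) hy)
    | succ n ih =>
      intro i j hij x hx y hy
      by_cases hi : i < 0
      · exact hneg' x (A.mem_neg hi hx) y
      by_cases hj : j < 0
      · exact hneg x y (A.mem_neg hj hy)
      push_cast at hij
      rw [← sub_eq_zero]
      refine (hφ 0).eq_zero_of_lie he hB (k := i + j) (by omega)
        (sub_mem ((hφ _).piece _ le_rfl _ (A.lie_mem hx hy))
          (B.lie_mem ((hφ _).piece _ le_rfl _ hx) ((hφ _).piece _ le_rfl _ hy))) fun t ht => ?_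
      refine A.part_induction (P := Set.Iio 0)
        (p := fun t => ⁅φ ⁅x, y⁆ - ⁅φ x, φ y⁆, φ t⁆ = 0) ?_ (by simp) ?_ ht
      · intro k hk t ht
        simp only [Set.mem_Iio] at hk
        have ht' := A.mem_neg hk ht
        rw [sub_lie, sub_eq_zero, ← hneg _ t ht', lie_lie x y t, lie_lie (φ x) (φ y) (φ t), map_sub,
          ← hneg y t ht', ← hneg x t ht', ih i (j + k) (by omega) x hx _ (A.lie_mem hy ht),
          ih j (i + k) (by omega) y hy _ (A.lie_mem hx ht)]
      · intro s t hs ht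
        rw [map_add, lie_add, hs, ht, add_zero]
  refine A.part_induction (p := fun x => φ ⁅x, y⁆ = ⁅φ x, φ y⁆) ?_ (by simp) ?_ (A.mem_part_univ x)
  · intro i _ x hx
    refine A.part_induction (p := fun y => φ ⁅x, y⁆ = ⁅φ x, φ y⁆) ?_ (by simp) ?_
      (A.mem_part_univ y)
    · intro j _ y hy
      exact key (i + j + 1).toNat i j (by omega) x hx y hy
    · intro a b ha hb
      rw [lie_add, map_add, ha, hb, map_add, lie_add]
  · intro a b ha hb
    rw [add_lie, map_add, ha, hb, map_add, add_lie]

theorem map_parity (he : A.IsNonposIso B e) (hB : B.IsTransitive)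
    (hφ : ∀ n, IsPartialExtension A B e n φ) {ε : ZMod 2} {x : L} (hx : x ∈ A.parity ε) :
    φ x ∈ B.parity ε := by
  have key : ∀ n : ℕ, ∀ ε, ∀ x ∈ A.part (Set.Iic (n : ℤ)), x ∈ A.parity ε → φ x ∈ B.parity ε := by
    intro n
    induction n with
    | zero =>
      intro ε x hx hε
      rw [(hφ 0).apply ⟨x, hx⟩]
      exact (he.parity ε ⟨x, hx⟩).1 hε
    | succ n ih =>
      intro ε x hx hε
      refine A.part_parity_induction (p := fun x => φ x ∈ B.parity ε) ?_ (by simp) ?_ hx hε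
      · intro k hk x hx hε
        rcases (show k ≤ (n : ℤ) + 1 by simpa using hk).lt_or_eq with hk | rfl
        · exact ih ε x (A.piece_le_part (P := Set.Iic (n : ℤ)) (Set.mem_Iic.2 (by omega)) hx) hε
        · refine mem_parity_of_lie hB (k := n + 1) (by omega) ((hφ _).piece _ le_rfl _ hx)
            fun δ y hy hδ => ?_
          have hy' := he.symm.apply_mem_neg (x := ⟨y, B.neg_le_nonpos hy⟩) hy
          have h : φ (e.symm ⟨y, B.neg_le_nonpos hy⟩) = y := by
            rw [(hφ 0).apply, LieEquiv.apply_symm_apply]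
          rw [← h, ← (hφ _).lie _ le_rfl x hx _ hy']
          exact ih _ _ (A.lie_neg_mem_part hx hy')
            (A.lie_mem_parity hε ((he.symm.parity δ ⟨y, B.neg_le_nonpos hy⟩).1 hδ))
      · intro a b _ _ ha hb
        rw [map_add]; exact add_mem ha hb
  refine A.part_parity_induction (p := fun x => φ x ∈ B.parity ε) ?_ (by simp) ?_
    (A.mem_part_univ x) hx
  · intro k _ x hx hε
    exact key k.toNat ε x (A.piece_le_part (Set.mem_Iic.2 (by omega)) hx) hε
  · intro a b _ _ ha hb
    rw [map_add]; exact add_mem ha hb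

theorem map_sq (he : A.IsNonposIso B e) (hB : B.IsTransitive)
    (hφ : ∀ n, IsPartialExtension A B e n φ) {x : L} (hx : x ∈ A.parity 1) :
    φ (A.sq x) = B.sq (φ x) := by
  refine A.part_parity_induction (p := fun x => φ (A.sq x) = B.sq (φ x)) ?_
    (by simp [sq_zero]) ?_ (A.mem_part_univ x) hx
  · intro k _ x hx h1
    have h1' := map_parity he hB hφ h1
    have hx' := (hφ k).piece k le_rfl x hx
    by_cases hk : k ≤ 0
    · have hm := A.mem_nonpos hk hx
      have hm2 := A.mem_nonpos (show 2 * k ≤ 0 by omega) (A.sq_mem_piece h1 hx)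
      rw [(hφ 0).apply ⟨x, hm⟩, (hφ 0).apply ⟨_, hm2⟩]
      exact he.sq ⟨x, hm⟩ ⟨_, hm2⟩ h1 rfl
    -- Both squares act as the double bracket, which φ respects, so transitivity identifies them.
    · rw [← sub_eq_zero]
      refine (hφ 0).eq_zero_of_lie he hB (k := 2 * k) (by omega)
        (sub_mem ((hφ _).piece _ le_rfl _ (A.sq_mem_piece h1 hx)) (B.sq_mem_piece h1' hx'))
        fun t _ => ?_
      rw [sub_lie, B.sq_lie _ h1', ← map_lie he hB hφ, A.sq_lie _ h1, ← map_lie he hB hφ,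
        ← map_lie he hB hφ, sub_self]
  · intro x y hx hy hx' hy'
    rw [A.sq_add hx hy, map_add φ x y, B.sq_add (map_parity he hB hφ hx) (map_parity he hB hφ hy),
      map_add, map_add, hx', hy', map_lie he hB hφ]

end IsPartialExtension

theorem IsHom.isPartialExtension {f : L →ₗ⁅K⁆ M} (hf : A.IsHom B f)
    (hfe : ∀ x : A.nonpos, f x = e x) (n : ℤ) : IsPartialExtension A B e n (f : L →ₗ[K] M) :=
  ⟨hfe, fun k _ => hf.piece k, fun _ _ x _ y _ => f.map_lie x y⟩

/-- An isomorphism of the non-positive parts has at most one extension to a homomorphism into a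
transitive graded Lie superalgebra. -/
theorem IsHom.ext (he : A.IsNonposIso B e) (hB : B.IsTransitive) {f f' : L →ₗ⁅K⁆ M}
    (hf : A.IsHom B f) (hfe : ∀ x : A.nonpos, f x = e x)
    (hf' : A.IsHom B f') (hfe' : ∀ x : A.nonpos, f' x = e x) : f' = f := by
  ext x
  refine A.part_induction (p := fun x => f' x = f x) ?_ (by simp) ?_ (A.mem_part_univ x)
  · intro k _ x hx
    exact IsPartialExtension.eqOn he hB (hf'.isPartialExtension hfe' k)
      (hf.isPartialExtension hfe k) (A.piece_le_part (Set.mem_Iic.2 le_rfl) hx)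
  · intro x y hx hy
    rw [map_add, map_add, hx, hy]

/-- An isomorphism of the non-positive parts extends to a homomorphism into a full prolong. -/
theorem exists_isHom [CharP K 2] (he : A.IsNonposIso B e) (hB : B.IsFullProlong) :
    ∃ f : L →ₗ⁅K⁆ M, A.IsHom B f ∧ ∀ x : A.nonpos, f x = e x := by
  obtain ⟨φ, hφ⟩ := IsPartialExtension.exists_forall he hB
  exact ⟨{ φ with map_lie' := fun {x y} => IsPartialExtension.map_lie he hB.1 hφ x y },
    ⟨fun k x hx => (hφ k).piece k le_rfl x hx,
      fun _ _ hx => IsPartialExtension.map_parity he hB.1 hφ hx,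
      fun _ hx => IsPartialExtension.map_sq he hB.1 hφ hx⟩, (hφ 0).apply⟩

/-- Brackets of a kernel element with negative elements are kernel elements of lower degree, so
induction applies, starting from the injectivity of `e`. -/
theorem IsHom.injective (hA : A.IsTransitive) {f : L →ₗ⁅K⁆ M}
    (hf : A.IsHom B f) (hfe : ∀ x : A.nonpos, f x = e x) : Function.Injective f := by
  have key : ∀ n : ℕ, ∀ k : ℤ, k ≤ n → ∀ x ∈ A.piece k, f x = 0 → x = 0 := by
    intro n
    induction n with
    | zero =>
      intro k hk x hx h0
      have hm := A.mem_nonpos hk hx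
      rw [hfe ⟨x, hm⟩] at h0
      have : (⟨x, hm⟩ : A.nonpos) = 0 := e.injective (by rw [map_zero]; exact Subtype.ext h0)
      exact congrArg Subtype.val this
    | succ n ih =>
      intro k hk x hx h0
      by_cases hk' : k ≤ n
      · exact ih k hk' x hx h0
      refine hA k (by omega) x hx fun y hy => ?_
      refine A.part_induction (P := Set.Iio 0) (p := fun y => ⁅x, y⁆ = 0) ?_ (by simp) ?_ hy
      · intro j hj y hy
        simp only [Set.mem_Iio] at hj
        push_cast at hk
        exact ih _ (by omega) _ (A.lie_mem hx hy) (by rw [LieHom.map_lie, h0, zero_lie])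
      · intro a b ha hb
        rw [lie_add, ha, hb, add_zero]
  exact A.injective_of_pieces B.toLieGrading f hf.piece fun k =>
    key k.toNat k (by omega)

theorem IsHom.comp {N : Type*} [LieRing N] [LieAlgebra K N] {C : GradedLieSuperalgebra K N}
    {f : L →ₗ⁅K⁆ M} {h : M →ₗ⁅K⁆ N} (hh : B.IsHom C h) (hf : A.IsHom B f) :
    A.IsHom C (h.comp f) where
  piece k x hx := hh.piece k _ (hf.piece k x hx)
  parity ε x hx := hh.parity ε _ (hf.parity ε x hx)
  sq x hx := by
    rw [LieHom.comp_apply, LieHom.comp_apply, hf.sq x hx, hh.sq _ (hf.parity 1 x hx)]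

theorem isHom_id (A : GradedLieSuperalgebra K L) : A.IsHom A (LieHom.id : L →ₗ⁅K⁆ L) :=
  ⟨fun _ _ hx => hx, fun _ _ hx => hx, fun _ _ => rfl⟩

theorem isNonposIso_refl (A : GradedLieSuperalgebra K L) :
    A.IsNonposIso A (LieEquiv.refl : A.nonpos ≃ₗ⁅K⁆ A.nonpos) :=
  ⟨fun _ _ => Iff.rfl, fun _ _ => Iff.rfl, fun _ _ _ h => h⟩

theorem IsHom.surjective [CharP K 2] (hA : A.IsFullProlong) (hB : B.IsTransitive)
    (he : A.IsNonposIso B e) {f : L →ₗ⁅K⁆ M} (hf : A.IsHom B f)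
    (hfe : ∀ x : A.nonpos, f x = e x) : Function.Surjective f := by
  obtain ⟨h, hh, hhe⟩ := exists_isHom he.symm hA
  -- The composite extends the identity of the non-positive part, as the identity does; uniqueness
  -- makes them equal.
  have hid : f.comp h = LieHom.id :=
    IsHom.ext B.isNonposIso_refl hB B.isHom_id (fun _ => rfl) (hf.comp hh) fun x => by
      rw [LieHom.comp_apply, hhe, hfe, LieEquiv.apply_symm_apply]; rfl
  exact fun z => ⟨h z, LieHom.congr_fun hid z⟩

end GradedLieSuperalgebra
-- Homogeneous structure of (g, gr).
namespace LieGrading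

/-- A linear subspace that contains the component of degree `-1` contains the negative part if it
is closed under brackets with that component. -/
theorem IsWeisfeiler.neg_le {K L : Type*} [Field K] [LieRing L] [LieAlgebra K L]
    {A : LieGrading K L} (hA : A.IsWeisfeiler) {W : Submodule K L} (h1 : A.piece (-1) ≤ W)
    (hlie : ∀ x ∈ A.piece (-1), ∀ y ∈ A.neg, y ∈ W → ⁅x, y⁆ ∈ W) : A.neg.toSubmodule ≤ W := by
  have key : ∀ n : ℕ, A.piece (-1 - n) ≤ W := by
    intro n
    induction n with
    | zero => simpa using h1
    | succ n ih =>
      rw [show (-1 - ((n + 1 : ℕ) : ℤ)) = (-1 - n : ℤ) - 1 by push_cast; ring,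
        hA.generated _ (by omega), Submodule.span_le]
      rintro _ ⟨x, hx, y, hy, rfl⟩
      exact hlie x hx y (A.mem_neg (by omega) hy) (ih hy)
  refine iSup₂_le fun k hk => ?_
  simp only [Set.mem_Iio] at hk
  have := key (-1 - k).toNat
  rwa [show (-1 - ((-1 - k).toNat : ℤ)) = k by omega] at this

end LieGrading

/-- Homogeneous components are unique: this turns membership in a sum of graded spans into
membership in the span of the right degree. -/
theorem iSupIndep.mem_of_mem_iSup {ι R V : Type*} [Ring R] [AddCommGroup V] [Module R V]
    {E H : ι → Submodule R V} (hE : iSupIndep E) (hle : ∀ i, H i ≤ E i) {i : ι} {v : V}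
    (hv : v ∈ E i) (hvH : v ∈ ⨆ j, H j) : v ∈ H i := by
  rw [iSup_split_single H i, Submodule.mem_sup] at hvH
  obtain ⟨a, ha, b, hb, rfl⟩ := hvH
  have hb' : b ∈ E i := by simpa using sub_mem hv (hle i ha)
  have hb0 : b = 0 := Submodule.disjoint_def.1 (hE i) b hb'
    ((iSup₂_mono fun j _ => hle j : (⨆ (j) (_ : j ≠ i), H j) ≤ ⨆ (j) (_ : j ≠ i), E j) hb)
  rwa [hb0, add_zero]

namespace MethodTwo

section
attribute [local instance] LieRing.ofAssociativeRing

variable {K g : Type*} [Field K] [LieRing g] [LieAlgebra K g] (A : LieGrading K g)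

theorem ad_injective [LieAlgebra.IsSimple K g] : Function.Injective (LieAlgebra.ad K g) := by
  rw [← LieHom.ker_eq_bot]
  exact LieAlgebra.ad_ker_eq_bot_of_hasTrivialRadical K g

theorem mem_iSup_map_ad (x : g) :
    LieAlgebra.ad K g x ∈ ⨆ k, (A.piece k).map (LieAlgebra.ad K g : g →ₗ[K] Module.End K g) := by
  rw [← Submodule.map_iSup, A.iSup_piece]
  exact ⟨x, trivial, rfl⟩

theorem mem_piece_of_ad [LieAlgebra.IsSimple K g] {k : ℤ} {x : g}
    (hx : LieAlgebra.ad K g x ∈ endPiece A k) : x ∈ A.piece k := by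
  obtain ⟨y, hy, hxy⟩ := (endPiece_iSupIndep A).mem_of_mem_iSup
    (H := fun k => (A.piece k).map (LieAlgebra.ad K g : g →ₗ[K] Module.End K g))
    (fun k => by rintro _ ⟨y, hy, rfl⟩; exact ad_mem_endPiece A hy) hx (mem_iSup_map_ad A x)
  exact ad_injective hxy ▸ hy

/-- The span of the elements of degree `k` of `g` and the squares of degree `k` of homogeneous odd
elements. -/
def generatorPiece (k : ℤ) : Submodule K (Module.End K g) :=
  (A.piece k).map (LieAlgebra.ad K g : g →ₗ[K] Module.End K g) ⊔
    Submodule.span K {f | ∃ j : ℤ, (j : ZMod 2) = 1 ∧ j + j = k ∧ ∃ x ∈ A.piece j,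
      f = LieAlgebra.ad K g x * LieAlgebra.ad K g x}

theorem generatorPiece_le_endPiece (k : ℤ) : generatorPiece A k ≤ endPiece A k := by
  refine sup_le ?_ (Submodule.span_le.2 ?_)
  · rintro _ ⟨x, hx, rfl⟩
    exact ad_mem_endPiece A hx
  · rintro _ ⟨j, -, rfl, x, hx, rfl⟩
    exact mul_mem_endPiece A (ad_mem_endPiece A hx) (ad_mem_endPiece A hx)

theorem lie_ad [CharP K 2] {f : Module.End K g} (hf : f ∈ algebra A) (y : g) :
    ⁅f, LieAlgebra.ad K g y⁆ = LieAlgebra.ad K g (f y) :=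
  (exists_ad_add A hf).1 y

/-- Evaluating [f, ad x] = ad(f x) at y shows that (g, gr) acts on g by derivations. -/
theorem apply_lie [CharP K 2] {f : Module.End K g} (hf : f ∈ algebra A) (x y : g) :
    f ⁅x, y⁆ = ⁅f x, y⁆ + ⁅x, f y⁆ := by
  have := LinearMap.congr_fun (lie_ad A hf x) y
  rw [Ring.lie_def] at this
  simpa [sub_eq_iff_eq_add] using this

/-- The span of ad g and the odd squares is already closed under brackets, since [f, (ad y)²] = [ad
y, ad(f y)] lies in ad g. Non-homogeneous squares add only brackets, by polarization. -/
theorem algebra_le_iSup_generatorPiece [CharP K 2] :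
    (algebra A).toSubmodule ≤ ⨆ k, generatorPiece A k := by
  have had : ∀ x, LieAlgebra.ad K g x ∈ ⨆ k, generatorPiece A k := fun x =>
    (iSup_mono fun k => le_sup_left : _ ≤ ⨆ k, generatorPiece A k) (mem_iSup_map_ad A x)
  have hle : (⨆ k, generatorPiece A k) ≤ (algebra A).toSubmodule := by
    refine iSup_le fun k => sup_le ?_ (Submodule.span_le.2 ?_)
    · rintro _ ⟨x, -, rfl⟩
      exact ad_mem A x
    · rintro _ ⟨j, hj, -, x, hx, rfl⟩
      exact ad_sq_mem A (A.piece_le_part hj hx)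
  have hlie : ∀ f ∈ algebra A, ∀ k, ∀ h ∈ generatorPiece A k,
      ⁅f, h⁆ ∈ ⨆ k, generatorPiece A k := by
    intro f hf k h hh
    obtain ⟨_, ⟨x, -, rfl⟩, b, hb, rfl⟩ := Submodule.mem_sup.1 hh
    rw [lie_add]
    refine add_mem ?_ ?_
    · exact (lie_ad A hf x).symm ▸ had _
    · refine Submodule.span_induction (p := fun b _ => ⁅f, b⁆ ∈ ⨆ k, generatorPiece A k)
        ?_ (by simp) ?_ ?_ hb
      · rintro _ ⟨j, -, -, y, -, rfl⟩
        rw [← lie_skew, lie_mul_self, ← lie_skew _ f, lie_ad A hf, lie_neg, neg_neg,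
          ← LieHom.map_lie]
        exact had _
      · intro a b _ _ ha hb
        rw [lie_add]; exact add_mem ha hb
      · intro a b _ hb
        rw [lie_smul]; exact Submodule.smul_mem _ a hb
  let M : LieSubalgebra K (Module.End K g) :=
    { (⨆ k, generatorPiece A k) with
      lie_mem' := fun {f h} hf hh =>
        Submodule.iSup_induction (motive := fun h => ⁅f, h⁆ ∈ ⨆ k, generatorPiece A k) _ hh
          (hlie f (hle hf)) (by simp) (fun a b ha hb => by rw [lie_add]; exact add_mem ha hb) }
  refine (LieSubalgebra.lieSpan_le.2 ?_ : algebra A ≤ M)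
  rintro f (⟨x, rfl⟩ | ⟨x, hx, rfl⟩)
  · exact had x
  · refine A.part_induction
      (p := fun x => LieAlgebra.ad K g x * LieAlgebra.ad K g x ∈ ⨆ k, generatorPiece A k)
      ?_ (by simp) ?_ hx
    · intro j hj x hx
      exact Submodule.mem_iSup_of_mem (j + j)
        (Submodule.mem_sup_right (Submodule.subset_span ⟨j, hj, rfl, x, hx, rfl⟩))
    · intro x y hx hy
      rw [map_add, add_mul_self, ← LieHom.map_lie]
      exact add_mem (add_mem hx hy) (had _)

theorem mem_generatorPiece [CharP K 2] {k : ℤ} {f : Module.End K g} (hf : f ∈ algebra A)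
    (hk : f ∈ endPiece A k) : f ∈ generatorPiece A k :=
  (endPiece_iSupIndep A).mem_of_mem_iSup (generatorPiece_le_endPiece A) hk
    (algebra_le_iSup_generatorPiece A hf)

variable {A}

/-- An element of degree `≥ 0` that annihilates the component of degree `-1` of `g` is zero. -/
theorem eq_zero_of_apply [CharP K 2] (hA : A.IsWeisfeiler) {k : ℤ} (hk : 0 ≤ k)
    {f : Module.End K g} (hf : f ∈ algebra A) (hfk : f ∈ endPiece A k)
    (h : ∀ y ∈ A.piece (-1), f y = 0) : f = 0 := by
  have hneg : A.neg.toSubmodule ≤ LinearMap.ker f :=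
    hA.neg_le h fun x hx y _ hy => by
      rw [LinearMap.mem_ker, apply_lie A hf, h x hx, LinearMap.mem_ker.1 hy, zero_lie, lie_zero,
        add_zero]
  have key : ∀ n : ℕ, ∀ j : ℤ, j < n → ∀ x ∈ A.piece j, f x = 0 := by
    intro n
    induction n with
    | zero => exact fun j hj x hx => hneg (A.mem_neg hj hx)
    | succ n ih =>
      -- For y of degree -1, [f x, y] = f[x, y] - [x, f y]; the first term vanishes by induction and
      -- the second by hypothesis, so f x = 0 by transitivity of g.
      intro j hj x hx
      push_cast at hj
      by_cases hj0 : j < 0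
      · exact hneg (A.mem_neg hj0 hx)
      refine hA.transitive (k + j) (by omega) _ (hfk j x hx) fun y hy => ?_
      have h1 := apply_lie A hf x y
      rwa [ih _ (by omega) _ (A.lie_mem hx hy), h y hy, lie_zero, add_zero, eq_comm] at h1
  ext x
  exact A.part_induction (p := fun x => f x = 0)
    (fun j _ x hx => key (j + 1).toNat j (by omega) x hx) (by simp)
    (fun x y hx hy => by rw [map_add, hx, hy, add_zero]) (A.mem_part_univ x)

/-- The components of degree `≥ 0` of `(g, gr)` are those of `g`. -/
theorem exists_ad_eq_of_nonneg [CharP K 2] (hA : A.IsWeisfeiler) (hprolong : A.IsFullProlong)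
    {k : ℤ} (hk : 0 ≤ k) {f : Module.End K g} (hf : f ∈ algebra A) (hfk : f ∈ endPiece A k) :
    ∃ z ∈ A.piece k, f = LieAlgebra.ad K g z := by
  rcases hk.eq_or_lt with rfl | hk
  · have hempty : {f : Module.End K g | ∃ j : ℤ, (j : ZMod 2) = 1 ∧ j + j = 0 ∧ ∃ x ∈ A.piece j,
        f = LieAlgebra.ad K g x * LieAlgebra.ad K g x} = ∅ := by
      refine Set.eq_empty_of_forall_notMem ?_
      rintro _ ⟨j, hj, h0, -⟩
      obtain rfl : j = 0 := by omega
      exact absurd hj (by decide)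
    have := mem_generatorPiece A hf hfk
    rw [generatorPiece, hempty, Submodule.span_empty, sup_bot_eq] at this
    obtain ⟨z, hz, rfl⟩ := this
    exact ⟨z, hz, rfl⟩
  · let D : LieDerivation K A.neg g :=
      { toLinearMap := f ∘ₗ A.neg.toSubmodule.subtype
        leibniz' := fun a b => by
          change f ⁅(a : g), (b : g)⁆ = ⁅(a : g), f b⁆ - ⁅(b : g), f a⁆
          rw [apply_lie A hf, ← lie_skew (f a)]
          abel }
    obtain ⟨z, hz, hD⟩ := hprolong.2 k hk D fun j x hx => by
      rw [add_comm]; exact hfk j x hx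
    refine ⟨z, hz, ?_⟩
    rw [← sub_eq_zero]
    -- Although ad z is only known to agree with f on the negative part, this determines it on all
    -- of g.
    refine eq_zero_of_apply hA hk.le (sub_mem hf (ad_mem A z))
      (sub_mem hfk (ad_mem_endPiece A hz)) fun y hy => ?_
    have h : f y = ⁅z, y⁆ := hD ⟨y, A.mem_neg (by omega) hy⟩
    rw [LinearMap.sub_apply, h, LieAlgebra.ad_apply, sub_self]

/-- Since [f, ad y] = ad(f y) and ad is injective, commuting with ad y means f y = 0. -/
theorem grading_isTransitive [CharP K 2] [LieAlgebra.IsSimple K g] (hA : A.IsWeisfeiler) :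
    (grading A).IsTransitive := by
  intro k hk f hf h
  refine Subtype.ext (eq_zero_of_apply hA hk f.2 hf fun y hy => ad_injective (K := K) ?_)
  have hy' : (⟨_, ad_mem A y⟩ : algebra A) ∈ (grading A).piece (-1) := ad_mem_endPiece A hy
  have := congrArg Subtype.val (h _ ((grading A).mem_neg (by omega) hy'))
  rw [map_zero, ← lie_ad A f.2]
  exact this

end

end MethodTwo
-- Derivations of the negative part of (g, gr).
section
attribute [local instance] LieRing.ofAssociativeRing

open MethodTwo

variable {K g : Type*} [Field K] [CharP K 2] [LieRing g] [LieAlgebra K g] {A : LieGrading K g}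

namespace MethodTwo

theorem ad_mem_neg {y : g} (hy : y ∈ A.neg) :
    (⟨LieAlgebra.ad K g y, ad_mem A y⟩ : algebra A) ∈ (grading A).neg := by
  refine A.part_induction (P := Set.Iio 0)
    (p := fun y => (⟨LieAlgebra.ad K g y, ad_mem A y⟩ : algebra A) ∈ (grading A).neg) ?_ ?_ ?_ hy
  · intro k hk y hy
    exact (grading A).mem_neg hk (ad_mem_endPiece A hy)
  · simp only [map_zero]
    exact zero_mem _
  · intro x y hx hy
    simp only [map_add]
    exact add_mem hx hy

/-- The inclusion of the negative part of `g` into that of `(g, gr)`. -/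
def adNeg (A : LieGrading K g) : A.neg →ₗ⁅K⁆ (grading A).neg where
  toFun y := ⟨⟨LieAlgebra.ad K g y, ad_mem A y⟩, ad_mem_neg y.2⟩
  map_add' x y := Subtype.ext (Subtype.ext (map_add (LieAlgebra.ad K g) (x : g) y))
  map_smul' a x := Subtype.ext (Subtype.ext (map_smul (LieAlgebra.ad K g) a (x : g)))
  map_lie' {x y} := Subtype.ext (Subtype.ext (LieHom.map_lie (LieAlgebra.ad K g) (x : g) y))

/-- A derivation of positive degree from the negative part of `(g, gr)` takes values in `g` on
the negative part of `g`. -/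
theorem derivation_adNeg_mem_range (hA : A.IsWeisfeiler) (hprolong : A.IsFullProlong) {k : ℤ}
    (hk : 0 < k) (D : LieDerivation K (grading A).neg (algebra A))
    (hD : ∀ j : ℤ, ∀ x : (grading A).neg,
      (x : algebra A) ∈ (grading A).piece j → D x ∈ (grading A).piece (j + k)) (y : A.neg) :
    ∃ w : g, (D (adNeg A y) : Module.End K g) = LieAlgebra.ad K g w := by
  let W : Submodule K A.neg := (LinearMap.range (LieAlgebra.ad K g : g →ₗ[K] Module.End K g)).comap
    ((algebra A).toSubmodule.subtype ∘ₗ D.toLinearMap ∘ₗ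
      (adNeg A : A.neg →ₗ[K] (grading A).neg))
  have hW : ∀ y : A.neg, y ∈ W ↔ ∃ w : g, LieAlgebra.ad K g w = D (adNeg A y) := fun y => Iff.rfl
  have hneg : A.neg.toSubmodule ≤ W.map A.neg.toSubmodule.subtype := by
    refine hA.neg_le ?_ ?_
    · intro y hy
      have hy' := A.mem_neg (by omega) hy
      -- Since k > 0, the image has degree k - 1 ≥ 0, where (g, gr) coincides with g.
      obtain ⟨z, -, hz⟩ := exists_ad_eq_of_nonneg hA hprolong (k := -1 + k) (by omega)
        (D (adNeg A ⟨y, hy'⟩)).2 (hD (-1) (adNeg A ⟨y, hy'⟩) (ad_mem_endPiece A hy))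
      exact ⟨⟨y, hy'⟩, (hW _).2 ⟨z, hz.symm⟩, rfl⟩
    · rintro x hx _ - ⟨y, hy, rfl⟩
      have hx' := A.mem_neg (by omega) hx
      obtain ⟨w, hw⟩ := (hW y).1 hy
      -- The witness comes from D[x, y] = [x, Dy] - [y, Dx], where Dy = ad w and -[ad y, Dx] =
      -- ad((Dx) y).
      refine ⟨⁅(⟨x, hx'⟩ : A.neg), y⁆, (hW _).2 ⟨⁅x, w⁆ +
        (D (adNeg A ⟨x, hx'⟩) : Module.End K g) y, ?_⟩, rfl⟩
      rw [LieHom.map_lie, LieDerivation.apply_lie_eq_sub, map_add, LieHom.map_lie, hw,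
        ← lie_ad A (D (adNeg A ⟨x, hx'⟩)).2]
      change _ = ⁅LieAlgebra.ad K g x, (D (adNeg A y) : Module.End K g)⁆ -
        ⁅LieAlgebra.ad K g y, (D (adNeg A ⟨x, hx'⟩) : Module.End K g)⁆
      rw [← lie_skew (LieAlgebra.ad K g (y : g)), sub_neg_eq_add]
  obtain ⟨y', hy', h⟩ := hneg y.2
  obtain rfl : y' = y := Subtype.ext h
  obtain ⟨w, hw⟩ := (hW _).1 hy'
  exact ⟨w, hw.symm⟩

/-- A derivation of positive degree from the negative part of `(g, gr)` is inner on the negative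
part of `g`. -/
theorem exists_derivation_adNeg_eq [LieAlgebra.IsSimple K g] (hA : A.IsWeisfeiler)
    (hprolong : A.IsFullProlong)
    {k : ℤ} (hk : 0 < k) (D : LieDerivation K (grading A).neg (algebra A))
    (hD : ∀ j : ℤ, ∀ x : (grading A).neg,
      (x : algebra A) ∈ (grading A).piece j → D x ∈ (grading A).piece (j + k)) :
    ∃ z ∈ (grading A).piece k, ∀ y : A.neg, D (adNeg A y) = ⁅z, (adNeg A y : algebra A)⁆ := by
  choose w hw using derivation_adNeg_mem_range hA hprolong hk D hD
  let D' : LieDerivation K A.neg g :=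
    { toFun := w
      map_add' := fun x y => ad_injective (K := K) <| by
        rw [map_add, ← hw, ← hw, ← hw, map_add, map_add]; rfl
      map_smul' := fun a x => ad_injective (K := K) <| by
        rw [RingHom.id_apply, map_smul, ← hw, ← hw, map_smul, map_smul]; rfl
      leibniz' := fun x y => ad_injective (K := K) <| by
        change LieAlgebra.ad K g (w ⁅x, y⁆) = LieAlgebra.ad K g (⁅(x : g), w y⁆ - ⁅(y : g), w x⁆)
        rw [map_sub, LieHom.map_lie, LieHom.map_lie, ← hw, ← hw, ← hw, LieHom.map_lie,
          LieDerivation.apply_lie_eq_sub]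
        rfl }
  obtain ⟨z, hz, hzD⟩ := hprolong.2 k hk D' fun j x hx => mem_piece_of_ad A <| by
    change LieAlgebra.ad K g (w x) ∈ _
    rw [← hw]
    exact hD j (adNeg A x) (ad_mem_endPiece A hx)
  refine ⟨⟨_, ad_mem A z⟩, ad_mem_endPiece A hz, fun y => Subtype.ext ?_⟩
  have h : w y = ⁅z, (y : g)⁆ := hzD y
  rw [hw, h, LieHom.map_lie]
  rfl

/-- The squares of the homogeneous odd elements of `g` together with `g` span `(g, gr)`, so that
two linear maps on the negative part agree if they agree on these elements. -/
theorem eqOn_neg {V : Type*} [AddCommGroup V] [Module K V]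
    {D E : (grading A).neg →ₗ[K] V} (h : ∀ y : A.neg, D (adNeg A y) = E (adNeg A y))
    (hsq : ∀ x y : (grading A).neg, (x : algebra A) ∈ (grading A).mod2 1 →
      (y : algebra A) = sq A x → (∃ u : A.neg, x = adNeg A u) → D y = E y) : D = E := by
  let W : Submodule K (Module.End K g) := ((LinearMap.eqLocus D E).map
    (grading A).neg.toSubmodule.subtype).map (algebra A).toSubmodule.subtype
  have hW : ∀ f : (grading A).neg, D f = E f → ((f : algebra A) : Module.End K g) ∈ W :=
    fun f hf => ⟨f, ⟨f, hf, rfl⟩, rfl⟩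
  have hgen : ∀ k < 0, generatorPiece A k ≤ W := by
    intro k hk
    refine sup_le ?_ (Submodule.span_le.2 ?_)
    · rintro _ ⟨x, hx, rfl⟩
      exact hW _ (h ⟨x, A.mem_neg hk hx⟩)
    · rintro _ ⟨j, hj, rfl, x, hx, rfl⟩
      -- A square of negative degree 2j has its root in negative degree j, so the hypothesis on
      -- squares applies.
      have hj0 : j < 0 := by omega
      have hx1 : (⟨_, ad_mem A x⟩ : algebra A) ∈ (grading A).mod2 1 :=
        (grading A).piece_le_part (P := {k : ℤ | (k : ZMod 2) = 1}) hj (ad_mem_endPiece A hx)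
      have hs : (⟨_, ad_sq_mem A (A.piece_le_part hj hx)⟩ : algebra A) ∈ (grading A).neg :=
        (grading A).mem_neg hk (mul_mem_endPiece A (ad_mem_endPiece A hx) (ad_mem_endPiece A hx))
      exact hW ⟨_, hs⟩ (hsq (adNeg A ⟨x, A.mem_neg hj0 hx⟩) _ hx1
        (Subtype.ext (coe_sq A hx1).symm) ⟨_, rfl⟩)
  have hmem : ∀ f : algebra A, f ∈ (grading A).neg → (f : Module.End K g) ∈ W := fun f hf =>
    (grading A).part_induction (P := Set.Iio 0) (p := fun f => (f : Module.End K g) ∈ W)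
      (fun k hk f hf => hgen k hk (mem_generatorPiece A f.2 hf)) (zero_mem _)
      (fun a b ha hb => add_mem ha hb) hf
  ext f
  obtain ⟨_, ⟨f', hf', rfl⟩, hff'⟩ := hmem f f.2
  obtain rfl : f' = f := Subtype.ext (Subtype.ext hff')
  exact hf'

end MethodTwo

/-- The element z found on ad g_- works everywhere: the squaring rule gives Dx² = [[z, x], x] = [z,
x²]. -/
theorem methodTwo_isFullProlong [LieAlgebra.IsSimple K g] (hA : A.IsWeisfeiler)
    (hprolong : A.IsFullProlong) :
    (methodTwo A).IsFullProlong := by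
  refine ⟨grading_isTransitive hA, fun k hk D hsq hD => ?_⟩
  obtain ⟨z, hz, hzD⟩ := exists_derivation_adNeg_eq hA hprolong hk D hD
  refine ⟨z, hz, fun f => ?_⟩
  let E : (grading A).neg →ₗ[K] algebra A :=
    (LieAlgebra.ad K (algebra A) z : algebra A →ₗ[K] algebra A) ∘ₗ
      (grading A).neg.toSubmodule.subtype
  have hDE : D.toLinearMap = E := by
    refine eqOn_neg hzD ?_
    rintro x y hx hy ⟨u, rfl⟩
    have hy' : (y : algebra A) = (methodTwo A).sq (adNeg A u : algebra A) := hy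
    have h : D y = ⁅⁅z, (adNeg A u : algebra A)⁆, (adNeg A u : algebra A)⁆ :=
      (hsq (adNeg A u) y hx hy).trans (congrArg (fun w => ⁅w, (adNeg A u : algebra A)⁆) (hzD u))
    refine h.trans ?_
    change _ = ⁅z, (y : algebra A)⁆
    rw [hy']
    exact ((methodTwo A).lie_sq z hx).symm
  exact LinearMap.congr_fun hDE f

end

theorem mainTheorem8 {K : Type*} [Field K] [CharP K 2]
    {g : Type*} [LieRing g] [LieAlgebra K g] [LieAlgebra.IsSimple K g]
    (A : LieGrading K g) (hA : A.IsWeisfeiler) (hprolong : A.IsFullProlong) :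
    (methodTwo A).IsFullProlong ∧
    ∀ (L : Type*) [LieRing L] [LieAlgebra K L] (B : GradedLieSuperalgebra K L),
      B.IsTransitive →
      ∀ e : B.nonpos ≃ₗ⁅K⁆ (methodTwo A).nonpos, B.IsNonposIso (methodTwo A) e →
        ∃ f : L →ₗ⁅K⁆ MethodTwo.algebra A,
          B.IsHom (methodTwo A) f ∧ (∀ x : B.nonpos, f x = e x) ∧
          Function.Injective f ∧
          (B.IsFullProlong → Function.Surjective f) ∧
          ∀ f' : L →ₗ⁅K⁆ MethodTwo.algebra A,
            B.IsHom (methodTwo A) f' → (∀ x : B.nonpos, f' x = e x) → f' = f := by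
  have hfull := methodTwo_isFullProlong hA hprolong
  refine ⟨hfull, fun L _ _ B hB e he => ?_⟩
  obtain ⟨f, hf, hfe⟩ := GradedLieSuperalgebra.exists_isHom he hfull
  exact ⟨f, hf, hfe, hf.injective hB hfe, fun hBfull => hf.surjective hBfull hfull.1 he hfe,
    fun f' hf' hfe' => hf.ext he hfull.1 hfe hf' hfe'⟩
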